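/- Let $d_A \ge d_B \ge 2$. A state is a positive semidefinite matrix of trace $1$; a state $\gamma_{AB}$ on $\mathbb{C}^{d_A}\otimes\mathbb{C}^{d_B}$ is separable if it is a convex combination of product states, and entangled otherwise; $\gamma_A=\mathrm{Tr}_B\,\gamma_{AB}$. Let $\mathcal{P}$ be the set of states $\gamma_{AB}$ with $\mathrm{rank}\,\gamma_{AB}=d_A=\mathrm{rank}\,\gamma_A$, and $\mathcal{P}_0=\{\gamma_{AB}\in\mathcal{P}:\gamma_A=\tfrac1{d_A}I\}$. A state in $\mathcal{P}$ is almost surely entangled, in the following two senses. (a) Let $n$ be any Borel probability measure on the unit sphere of $\mathbb{C}^{d_B}$. For $u,v\in[0,\tfrac{\pi}{2}]$ let $\Phi_{u,v}$ be the qubit channel $w_0I+\sum_k w_k\sigma_k\mapsto w_0I+w_1\cos u\,\sigma_1+w_2\cos v\,\sigma_2+(w_0\sin u\sin v+w_3\cos u\cos v)\,\sigma_3$, and let $C_{u,v}=\sum_{j,k\le 2}|e_j\rangle\langle e_k|\otimes\Phi_{u,v}(|e_j\rangle\langle e_k|)$. For a $4\times4$ matrix $C$, an isometry $V:\mathbb{C}^2\to\mathbb{C}^{d_B}$,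 $U\in SU(d_A)$ with columns $g_1,\dots,g_{d_A}$, and unit vectors $\psi_3,\dots,\psi_{d_A}\in\mathbb{C}^{d_B}$, put $$\gamma(C,V,U,\psi)=\tfrac1{d_A}\Big(Q\oplus\sum_{k=3}^{d_A}|g_k\rangle\langle g_k|\otimes|\psi_k\rangle\langle\psi_k|\Big),$$ where $Q$ is $C$ transported by $e_j\otimes e_m\mapsto g_j\otimes Ve_m$. Let $\mathcal{Y}\subset\mathcal{P}_0$ be the set of the states in $\mathcal{P}_0$ of the form $\gamma(C,V,U,\psi)$ with $C\ge0$, $\mathrm{rank}\,C=2$, $\mathrm{Tr}_B\,C=I_2$. Let $\mu$ be the law of $\gamma(C_{u,v},V,U,\psi)$ when, independently, $(u,v)$ is uniform in $[0,\tfrac{\pi}{2}]^2$, $V$ consists of the first two columns of a Haar-random element of $SU(d_B)$, $U$ is Haar-random in $SU(d_A)$, and the $\psi_k$ have law $n$. Let $\eta$ be the law of $U\,\mathrm{diag}(\zeta)\,U^\dagger$ with $\zeta$ uniform in $\{0<\zeta_1\le\dots\le\zeta_{d_A},\ \sum_k\zeta_k=1\}$ and $U$ independent and Haar-random in $SU(d_A)$.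 Then $\mu$ and $\eta$ are probability measures and $\mu$ is concentrated on $\mathcal{P}_0$. Moreover, for every s-finite Borel measure $\omega$ on matrices that is concentrated on $\mathcal{P}_0$ and extends $\mu$ (that is, $\omega(X)=\mu(X)$ for every Borel $X\subseteq\mathcal{Y}$; for instance $\omega=\mu$), for $\omega\times\eta$-almost every $(\gamma,\rho)$ the matrix $(\sqrt{d_A\rho}\otimes I)\,\gamma\,(\sqrt{d_A\rho}\otimes I)$ belongs to $\mathcal{P}$ and is entangled. (b) For Lebesgue-almost every complex $d_Ad_B\times d_A$ matrix $W$, the matrix $WW^\dagger/\mathrm{Tr}(WW^\dagger)$ belongs to $\mathcal{P}$ and is entangled. -/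

import Mathlib

open MeasureTheory
open scoped Kronecker ComplexOrder Matrix

noncomputable section

namespace Bipartite

/-! ### Borel structure on matrix spaces and on `SU(d)` -/

instance instMeasurableSpaceMatrix {m n : Type*} : MeasurableSpace (Matrix m n ℂ) :=
  inferInstanceAs (MeasurableSpace (m → n → ℂ))

instance instSecondCountableMatrix {m n : Type*} [Countable m] [Countable n] :
    SecondCountableTopology (Matrix m n ℂ) :=
  inferInstanceAs (SecondCountableTopology (m → n → ℂ))

instance instBorelSpaceMatrix {m n : Type*} [Countable m] [Countable n] :
    BorelSpace (Matrix m n ℂ) :=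
  inferInstanceAs (BorelSpace (m → n → ℂ))

/-- The special unitary group `SU(d)`. -/
abbrev SU (d : ℕ) : Type := Matrix.specialUnitaryGroup (Fin d) ℂ

instance instIsTopologicalGroupSU (d : ℕ) : IsTopologicalGroup (SU d) where
  continuous_inv := by
    refine Continuous.subtype_mk (f := fun U : SU d => (U : Matrix (Fin d) (Fin d) ℂ)ᴴ) ?_ _
    exact continuous_subtype_val.matrix_conjTranspose

instance instCompactSpaceSU (d : ℕ) : CompactSpace (SU d) := by
  refine (isCompact_iff_compactSpace
    (s := (Matrix.specialUnitaryGroup (Fin d) ℂ : Set (Matrix (Fin d) (Fin d) ℂ)))).mp ?_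
  have hK : IsCompact (Set.pi Set.univ (fun _ : Fin d =>
      Set.pi Set.univ (fun _ : Fin d => Metric.closedBall (0 : ℂ) 1))) :=
    isCompact_univ_pi fun _ => isCompact_univ_pi fun _ => isCompact_closedBall _ _
  have hset : ((Matrix.specialUnitaryGroup (Fin d) ℂ : Set (Matrix (Fin d) (Fin d) ℂ))) =
      {A | A * Aᴴ = 1} ∩ {A | A.det = 1} := by
    ext A
    simp only [SetLike.mem_coe, Matrix.mem_specialUnitaryGroup_iff, Matrix.mem_unitaryGroup_iff,
      Set.mem_inter_iff, Set.mem_ofPred_eq, Matrix.star_eq_conjTranspose]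
  have hcl : IsClosed ((Matrix.specialUnitaryGroup (Fin d) ℂ :
      Set (Matrix (Fin d) (Fin d) ℂ))) := by
    rw [hset]
    refine IsClosed.inter ?_ ?_
    · exact isClosed_eq (continuous_id.matrix_mul continuous_id.matrix_conjTranspose)
        continuous_const
    · exact isClosed_eq continuous_id.matrix_det continuous_const
  refine IsCompact.of_isClosed_subset (s := (Set.pi Set.univ (fun _ : Fin d =>
      Set.pi Set.univ (fun _ : Fin d => Metric.closedBall (0 : ℂ) 1)) :
        Set (Matrix (Fin d) (Fin d) ℂ))) hK hcl ?_
  intro A hA i _ j _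
  rw [mem_closedBall_zero_iff]
  exact entry_norm_bound_of_unitary (Matrix.specialUnitaryGroup_le_unitaryGroup hA) i j

/-- The normalized Haar measure on `SU(d)`. -/
def haarSU (d : ℕ) : Measure (SU d) := Measure.haarMeasure ⊤

/-! ### Bipartite states -/

/-- Matrices in `M_a ⊗ M_b`, indexed by the product basis `e_i ⊗ f_m`. -/
abbrev BiMat (a b : ℕ) : Type := Matrix (Fin a × Fin b) (Fin a × Fin b) ℂ

/-- Density matrices: positive semidefinite of trace one. -/
def IsState {n : Type*} [Fintype n] (ρ : Matrix n n ℂ) : Prop :=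
  ρ.PosSemidef ∧ ρ.trace = 1

/-- The partial trace over the second factor, `Tr_B`; `γ_A = Tr_B γ_AB`. -/
def traceB {a b : ℕ} (γ : BiMat a b) : Matrix (Fin a) (Fin a) ℂ :=
  Matrix.of fun i j => ∑ m, γ (i, m) (j, m)

/-- A separable state: a convex combination of product states. -/
def IsSeparable {a b : ℕ} (γ : BiMat a b) : Prop :=
  γ ∈ convexHull ℝ {τ : BiMat a b | ∃ (α : Matrix (Fin a) (Fin a) ℂ)
    (β : Matrix (Fin b) (Fin b) ℂ), IsState α ∧ IsState β ∧ τ = α ⊗ₖ β}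

/-- An entangled state: a state that is not separable. -/
def IsEntangled {a b : ℕ} (γ : BiMat a b) : Prop :=
  IsState γ ∧ ¬ IsSeparable γ

/-- `𝒫_A(r, s)`: the states with `rank γ_AB = r` and `rank γ_A = s`. -/
def statesOfRank (a b r s : ℕ) : Set (BiMat a b) :=
  {γ | IsState γ ∧ γ.rank = r ∧ (traceB γ).rank = s}

/-- `𝒫_A(ρ; r, s)`: the states in `𝒫_A(r, s)` with `γ_A = ρ`. -/
def statesWithMarginal {a : ℕ} (b : ℕ) (ρ : Matrix (Fin a) (Fin a) ℂ) (r s : ℕ) :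
    Set (BiMat a b) :=
  {γ | γ ∈ statesOfRank a b r s ∧ traceB γ = ρ}

/-- The maximally mixed state `I / d`. -/
def maxMixed (d : ℕ) : Matrix (Fin d) (Fin d) ℂ := (d : ℂ)⁻¹ • 1

/-- `𝒫_A(I/a; a, a)`: the (normalized) Choi matrices, of rank `a`, of trace-preserving
completely positive maps `M_a → M_b`. -/
abbrev channelStates (a b : ℕ) : Set (BiMat a b) := statesWithMarginal b (maxMixed a) a a

/-! ### Qubit channels of Choi rank at most two -/

/-- The identity and the Pauli matrices. -/
def pauli : Fin 4 → Matrix (Fin 2) (Fin 2) ℂ :=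
  ![1, !![0, 1; 1, 0], !![0, -Complex.I; Complex.I, 0], !![1, 0; 0, -1]]

/-- The matrix, in the basis of Pauli matrices, of the channel with parameters `(u, v)`. -/
def blochMatrix (u v : ℝ) : Matrix (Fin 4) (Fin 4) ℝ :=
  !![1, 0, 0, 0;
     0, Real.cos u, 0, 0;
     0, 0, Real.cos v, 0;
     Real.sin u * Real.sin v, 0, 0, Real.cos u * Real.cos v]

/-- The channel `Φ_{u,v} : M_2 → M_2`, `∑ w_k σ_k ↦ ∑_j (∑_k T_{jk} w_k) σ_j`,
where `w_k = Tr(σ_k X) / 2`. -/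
def qubitChannel (u v : ℝ) (X : Matrix (Fin 2) (Fin 2) ℂ) : Matrix (Fin 2) (Fin 2) ℂ :=
  ∑ j, ∑ k, ((blochMatrix u v j k : ℂ) * ((pauli k * X).trace / 2)) • pauli j

/-- The (unnormalized) Choi matrix `∑_{jk} |e_j⟩⟨e_k| ⊗ Φ_{u,v}(|e_j⟩⟨e_k|)`. -/
def qubitChoi (u v : ℝ) : BiMat 2 2 :=
  ∑ j, ∑ k, Matrix.single j k 1 ⊗ₖ qubitChannel u v (Matrix.single j k 1)

/-! ### The parametrized block-diagonal states and their measure -/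

/-- `𝒱_b`: the isometries `ℂ² → ℂᵇ`. -/
abbrev Isom2 (b : ℕ) : Type := {V : Matrix (Fin b) (Fin 2) ℂ // Vᴴ * V = 1}

/-- The `d × 2` matrix with columns `e_1, e_2`. -/
def firstTwo (d : ℕ) : Matrix (Fin d) (Fin 2) ℂ :=
  Matrix.of fun i k => if (i : ℕ) = (k : ℕ) then 1 else 0

/-- The unit sphere of `ℂᵇ`. -/
abbrev Sphere (b : ℕ) : Type := Metric.sphere (0 : EuclideanSpace ℂ (Fin b)) 1

/-- The indices `k = 3, …, a` (counting from one). -/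
abbrev Tail (a : ℕ) : Type := {k : Fin a // 2 ≤ (k : ℕ)}

/-- The projection `|ψ⟩⟨ψ|`. -/
def proj {n : Type*} (ψ : n → ℂ) : Matrix n n ℂ := Matrix.vecMulVec ψ (star ψ)

/-- With `g_k` the columns of `U`, the matrix
`(1/a) (Q ⊕ ∑_{k ≥ 3} |g_k⟩⟨g_k| ⊗ |ψ_k⟩⟨ψ_k|)`, where `Q` is the matrix `C` transported to
`span{g_1, g_2} ⊗ range V` by `e_j ⊗ e_m ↦ g_j ⊗ V e_m`. -/
def blockState {a b : ℕ} (C : BiMat 2 2) (V : Isom2 b) (U : SU a) (ψ : Tail a → Sphere b) :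
    BiMat a b :=
  (a : ℂ)⁻¹ •
    ((((U : Matrix (Fin a) (Fin a) ℂ) * firstTwo a) ⊗ₖ V.1) * C *
        (((U : Matrix (Fin a) (Fin a) ℂ) * firstTwo a) ⊗ₖ V.1)ᴴ
      + ∑ k : Tail a, proj (fun i => (U : Matrix (Fin a) (Fin a) ℂ) i k.1) ⊗ₖ
          proj (fun m => (ψ k : EuclideanSpace ℂ (Fin b)) m))

/-- `𝒴`: all states in `𝒫_A(I/a; a, a)` of the block form above. -/
def blockStates (a b : ℕ) : Set (BiMat a b) :=
  {γ | γ ∈ channelStates a b ∧ ∃ (C : BiMat 2 2) (V : Isom2 b) (U : SU a) (ψ : Tail a → Sphere b),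
    C.PosSemidef ∧ C.rank = 2 ∧ traceB C = 1 ∧ γ = blockState C V U ψ}

/-- The parameter space `Δ̄ × 𝒱_b × SU(a) × (unit spheres)`; the angles `(u, v)` are taken in `ℝ²`
and the measure on them is carried by the square `[0, π/2]²`. -/
abbrev Param (a b : ℕ) : Type := (ℝ × ℝ) × Isom2 b × SU a × (Tail a → Sphere b)

/-- The parametrization `G`. -/
def paramState {a b : ℕ} (x : Param a b) : BiMat a b :=
  blockState (qubitChoi x.1.1 x.1.2) x.2.1 x.2.2.1 x.2.2.2

/-- Normalized Lebesgue measure on the square `[0, π/2]²`. -/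
def angleMeasure : Measure (ℝ × ℝ) :=
  ProbabilityTheory.cond volume
    (Set.Icc (0 : ℝ) (Real.pi / 2) ×ˢ Set.Icc (0 : ℝ) (Real.pi / 2))

theorem firstTwo_isometry {b : ℕ} (hb : 2 ≤ b) (W : SU b) :
    ((W : Matrix (Fin b) (Fin b) ℂ) * firstTwo b)ᴴ * ((W : Matrix (Fin b) (Fin b) ℂ) * firstTwo b)
      = 1 := by
  have hW : (W : Matrix (Fin b) (Fin b) ℂ)ᴴ * (W : Matrix (Fin b) (Fin b) ℂ) = 1 :=
    Matrix.mem_unitaryGroup_iff'.1 (Matrix.specialUnitaryGroup_le_unitaryGroup W.2)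
  rw [Matrix.conjTranspose_mul, Matrix.mul_assoc, ← Matrix.mul_assoc _ _ (firstTwo b), hW,
    Matrix.one_mul]
  ext j k
  rw [Matrix.mul_apply, Finset.sum_eq_single (⟨k, by omega⟩ : Fin b)]
  · simp only [firstTwo, Matrix.conjTranspose_apply, Matrix.of_apply, Matrix.one_apply, Fin.ext_iff]
    by_cases h : (k : ℕ) = (j : ℕ)
    · simp [h]
    · simp [h, Ne.symm h]
  · intro i _ hi
    have : (i : ℕ) ≠ (k : ℕ) := fun h => hi (Fin.ext h)
    simp [firstTwo, this]
  · simp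

/-- The `SU(b)`-invariant probability measure on `𝒱_b`: the law of the first two columns of a
Haar-distributed element of `SU(b)`. -/
def isomMeasure (b : ℕ) (hb : 2 ≤ b) : Measure (Isom2 b) :=
  (haarSU b).map fun W : SU b => ⟨(W : Matrix (Fin b) (Fin b) ℂ) * firstTwo b, firstTwo_isometry hb W⟩

/-- The product measure on the parameter space, for a probability measure `n` on the sphere. -/
def paramMeasure (a b : ℕ) (hb : 2 ≤ b) (n : Measure (Sphere b)) : Measure (Param a b) :=
  angleMeasure.prod ((isomMeasure b hb).prod ((haarSU a).prod (Measure.pi fun _ => n)))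

/-- The measure `μ = G_* (product measure)`. -/
def blockMeasure (a b : ℕ) (hb : 2 ≤ b) (n : Measure (Sphere b)) : Measure (BiMat a b) :=
  (paramMeasure a b hb n).map paramState

/-! ### The measure on density matrices of full rank -/

/-- The vector `(ζ_1, …, ζ_d)` of sum one with first `d - 1` coordinates `w`. -/
def simplexPoint (d : ℕ) (w : Fin (d - 1) → ℝ) (i : Fin d) : ℝ :=
  if h : (i : ℕ) < d - 1 then w ⟨i, h⟩ else 1 - ∑ k, w k

/-- The set `Z` of ordered vectors `0 < ζ_1 ≤ … ≤ ζ_d` of sum one, in the coordinates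
`ζ_1, …, ζ_{d-1}`. -/
def orderedSimplex (d : ℕ) : Set (Fin (d - 1) → ℝ) :=
  {w | (∀ i, 0 < simplexPoint d w i) ∧ Monotone (simplexPoint d w)}

/-- The measure `η` on density matrices of full rank: the law of `U Λ_ζ U†` with `ζ` uniform in `Z`
and `U` Haar-distributed in `SU(d)`. -/
def marginalMeasure (d : ℕ) : Measure (Matrix (Fin d) (Fin d) ℂ) :=
  ((ProbabilityTheory.cond volume (orderedSimplex d)).prod (haarSU d)).map fun p =>
    (p.2 : Matrix (Fin d) (Fin d) ℂ) *
      Matrix.diagonal (fun i => (simplexPoint d p.1 i : ℂ)) * (p.2 : Matrix (Fin d) (Fin d) ℂ)ᴴ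

/-- The identification `(γ, ρ) ↦ (√(aρ) ⊗ I) γ (√(aρ) ⊗ I)` of
`𝒫_A(I/a; a, a) × {ρ of full rank}` with `𝒫_A(a, a)`. -/
def withMarginal {a b : ℕ} (p : BiMat a b × Matrix (Fin a) (Fin a) ℂ) : BiMat a b :=
  (cfc Real.sqrt ((a : ℝ) • p.2) ⊗ₖ (1 : Matrix (Fin b) (Fin b) ℂ)) * p.1 *
    (cfc Real.sqrt ((a : ℝ) • p.2) ⊗ₖ (1 : Matrix (Fin b) (Fin b) ℂ))

/-- The state `W W† / Tr(W W†)`. -/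
def inducedState {a b r : ℕ} (W : Matrix (Fin a × Fin b) (Fin r) ℂ) : BiMat a b :=
  ((W * Wᴴ).trace)⁻¹ • (W * Wᴴ)

end Bipartite

end

open Bipartite

noncomputable section

namespace Bipartite

/-! ### Rank factorizations and simultaneous diagonalization -/

/-! Write a state of rank `a` as W W† with W an ab × a matrix of full column rank, and cut W into
slices W_m, one a × a block for each basis vector of the second factor. If W W† is also a sum of
product projections, the matrix Z of the product vectors α_k ⊗ β_k equals W E with E E† = 1. A
functional that vanishes on none of the β_k combines the slices into a matrix W_x, which is
invertible because the marginal is, and the columns of E are common eigenvectors of all W_x⁻¹ W_m.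
Since these columns resolve the identity, the W_x⁻¹ W_m are simultaneously unitarily diagonalizable,
so W_m = A D_m R with D_m diagonal, R unitary, and A and R independent of m
(`exists_slice_factorization`). Hence W W† is a sum of only `a` product projections, and adj(W_m)
W_m' is normal (`commute_adjugate_mul_of_mem_sepCone`).

For (a), the marginal I/a makes the `a` vectors of the first factor orthonormal after rescaling, so
every separable state of 𝒫₀ is a `productState` (`exists_productState_of_mem_sepCone`). These states
form a compact subset of 𝒴, where ω agrees with μ. The measure μ does not charge it: for u, v
strictly between 0 and π/2, a separable block state would compress to a separable `qubitChoi u v`,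
and normality would force cos u cos v = 0. So ω-almost every state is entangled. For positive
definite ρ the filter √(aρ) ⊗ I is local and invertible; it keeps the entanglement and changes the
marginal to ρ.

For (b), the normality criterion fails generically. Moving W_1 to W_1 + t·1 with t real, the entries
of the commutator of adj(W_0) W_1 with its adjoint are polynomials in t, and their quadratic
coefficients come from adj(W_0) alone. One of these is nonzero once W_0 is invertible and not
normal, which is itself generic; Fubini along lines concludes. -/

theorem exists_unitary_diagonal {n : Type*} [Fintype n] [DecidableEq n] {H : Matrix n n ℂ}
    (hH : H.IsHermitian) :
    ∃ (U : Matrix n n ℂ) (l : n → ℝ), U ∈ Matrix.unitaryGroup n ℂ ∧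
      H = U * Matrix.diagonal (fun i => (l i : ℂ)) * Uᴴ ∧
      H.rank = Fintype.card {i // l i ≠ 0} ∧ (H.PosSemidef → ∀ i, 0 ≤ l i) := by
  refine ⟨hH.eigenvectorUnitary, hH.eigenvalues, hH.eigenvectorUnitary.2, ?_,
    hH.rank_eq_card_non_zero_eigs, fun h => h.eigenvalues_nonneg⟩
  conv_lhs => rw [hH.spectral_theorem, Unitary.conjStarAlgAut_apply]
  rfl

/-- Only nonzero eigenvalues contribute, so r rescaled eigenvectors suffice. Having exactly as many
columns as the rank is what makes the Gram matrix of the factor invertible later. -/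
theorem exists_rank_factorization {n : Type*} [Fintype n] [DecidableEq n] {r : ℕ}
    {C : Matrix n n ℂ} (hC : C.PosSemidef) (hr : C.rank = r) :
    ∃ K : Matrix n (Fin r) ℂ, C = K * Kᴴ := by
  obtain ⟨U, l, -, hs, hrank, hpos⟩ := exists_unitary_diagonal hC.1
  specialize hpos hC
  have hcard : Fintype.card {i // l i ≠ 0} = Fintype.card (Fin r) := by
    rw [← hrank, hr, Fintype.card_fin]
  let e := (Fintype.equivOfCardEq hcard).symm
  refine ⟨Matrix.of fun i k => U i (e k) * (Real.sqrt (l (e k)) : ℂ), ?_⟩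
  ext i j
  have h1 : C i j = ∑ k, U i k * (l k : ℂ) * star (U j k) := by
    rw [hs, Matrix.mul_apply]
    simp only [Matrix.mul_diagonal, Matrix.conjTranspose_apply]
  have h2 : ∀ k : {i // l i ≠ 0},
      (U i k * (Real.sqrt (l k) : ℂ)) * star (U j k * (Real.sqrt (l k) : ℂ)) =
      U i k * (l k : ℂ) * star (U j k) := by
    intro k
    have : ((Real.sqrt (l k) : ℝ) : ℂ) * (Real.sqrt (l k) : ℝ) = (l k : ℂ) := by
      rw [← Complex.ofReal_mul, Real.mul_self_sqrt (hpos k)]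
    rw [star_mul', Complex.star_def, Complex.conj_ofReal, ← this]
    ring
  have h3 : ∑ k, U i k * (l k : ℂ) * star (U j k) =
      ∑ k : {i // l i ≠ 0}, U i k * (l k : ℂ) * star (U j k) := by
    rw [← Finset.sum_subtype (Finset.univ.filter fun k => l k ≠ 0) (by simp)
      (fun k => U i k * (l k : ℂ) * star (U j k)), Finset.sum_filter_of_ne]
    intro k _ hk hl
    simp [hl] at hk
  rw [h1, h3, Matrix.mul_apply, ← Equiv.sum_comp e]
  exact Finset.sum_congr rfl fun k _ => (h2 (e k)).symm

theorem isUnit_det_iff_rank {n : Type*} [Fintype n] [DecidableEq n] (A : Matrix n n ℂ) :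
    IsUnit A.det ↔ A.rank = Fintype.card n := by
  rw [← Matrix.isUnit_iff_isUnit_det]
  refine ⟨Matrix.rank_of_isUnit A, fun h => ?_⟩
  rw [← Matrix.mulVec_surjective_iff_isUnit]
  refine (LinearMap.range_eq_top (f := A.mulVecLin)).1 (Submodule.eq_top_of_finrank_eq ?_)
  rw [Module.finrank_fintype_fun_eq_card]
  exact h

/-- A subspace invariant under a diagonal matrix reduces it. -/
theorem commute_diagonal_of_intertwine {n κ : Type*} [Fintype n] [DecidableEq n] [Fintype κ]
    [DecidableEq κ] {E : Matrix n κ ℂ} (hE : E * Eᴴ = 1) {N : Matrix n n ℂ} {d : κ → ℂ}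
    (hN : N * E = E * Matrix.diagonal d) :
    Eᴴ * E * Matrix.diagonal d = Matrix.diagonal d * (Eᴴ * E) := by
  set P := Eᴴ * E with hP
  set D := Matrix.diagonal d with hD
  have hPP : P * P = P := by
    rw [hP, Matrix.mul_assoc, ← Matrix.mul_assoc E, hE, Matrix.one_mul]
  have hPs : Pᴴ = P := by simp [hP]
  have hDD : Dᴴ * D = D * Dᴴ := by
    simp [hD, Matrix.diagonal_conjTranspose, Matrix.diagonal_mul_diagonal, mul_comm]
  -- Since E D = N E, the kernel of E is invariant under D: this is one half of the commutation.
  have h1 : P * D * P = P * D := by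
    have : E * D * P = E * D := by
      rw [← hN, hP, Matrix.mul_assoc, ← Matrix.mul_assoc E, hE, Matrix.one_mul]
    rw [hP, Matrix.mul_assoc Eᴴ, Matrix.mul_assoc Eᴴ, ← hP, this]
  -- As D is normal, the other half follows: the squared Hilbert–Schmidt norm of D P - P D cancels
  -- by cyclicity of the trace.
  have h0 : ((D * P - P * D)ᴴ * (D * P - P * D)).trace = 0 := by
    have e1 : (D * P - P * D)ᴴ * (D * P - P * D) =
        P * (Dᴴ * D * P) - P * Dᴴ * P * D - Dᴴ * (P * D * P) + Dᴴ * (P * P) * D := by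
      simp only [Matrix.conjTranspose_sub, Matrix.conjTranspose_mul, hPs]
      noncomm_ring
    rw [e1, h1, hPP, Matrix.trace_add, Matrix.trace_sub, Matrix.trace_sub, Matrix.trace_mul_comm P,
      Matrix.mul_assoc (Dᴴ * D), hPP]
    have e2 : (P * Dᴴ * P * D).trace = (Dᴴ * D * P).trace := by
      rw [Matrix.mul_assoc, Matrix.mul_assoc, Matrix.trace_mul_comm, Matrix.mul_assoc,
        Matrix.mul_assoc, ← Matrix.mul_assoc P D P, h1, ← Matrix.mul_assoc, Matrix.mul_assoc,
        Matrix.trace_mul_comm, Matrix.mul_assoc, Matrix.trace_mul_comm, ← hDD]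
    rw [e2, Matrix.mul_assoc Dᴴ P D]
    ring
  exact (sub_eq_zero.1 (Matrix.trace_conjTranspose_mul_self_eq_zero_iff.1 h0)).symm

/-- Matrices which share a spanning family of eigenvectors `E_k` with `∑ |E_k⟩⟨E_k| = 1` are
simultaneously unitarily diagonalizable. -/
theorem exists_unitary_diagonalizing {n κ ι : Type*} [Fintype n] [DecidableEq n] [Fintype κ]
    [DecidableEq κ] {E : Matrix n κ ℂ} (hE : E * Eᴴ = 1) {N : ι → Matrix n n ℂ} {d : ι → κ → ℂ}
    (hN : ∀ m, N m * E = E * Matrix.diagonal (d m)) :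
    ∃ (U : Matrix n n ℂ) (l : ι → n → ℂ), U ∈ Matrix.unitaryGroup n ℂ ∧
      ∀ m, N m * U = U * Matrix.diagonal (l m) := by
  let v : κ → ι → ℂ := fun k m => d m k
  -- Each distinct tuple of joint eigenvalues gets its own real label, so that the single Hermitian
  -- matrix E F E† separates all joint eigenspaces at once.
  let f : κ → ℝ := fun k => ((Finite.equivFin (Set.range v) ⟨v k, k, rfl⟩ : ℕ) : ℝ)
  have hf : ∀ {k l}, f k = f l → v k = v l := by
    intro k l h
    have h1 := Nat.cast_injective (R := ℝ) h
    have h2 := (Finite.equivFin (Set.range v)).injective (Fin.ext h1)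
    exact congrArg Subtype.val h2
  have hf' : ∀ {k l}, v k = v l → f k = f l := by
    intro k l h
    simp only [f, h]
  -- E†E commutes with every `diagonal (d m)`, so it links only indices with equal joint
  -- eigenvalues.
  have hP : ∀ k l, (Eᴴ * E) k l ≠ 0 → v k = v l := by
    intro k l h
    funext m
    have := congrFun₂ (commute_diagonal_of_intertwine hE (hN m)) k l
    rw [Matrix.mul_diagonal, Matrix.diagonal_mul, mul_comm] at this
    exact (mul_right_cancel₀ h this).symm
  have hPf : Matrix.diagonal (fun k => (f k : ℂ)) * (Eᴴ * E) =
      Eᴴ * E * Matrix.diagonal (fun k => (f k : ℂ)) := by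
    ext k l
    rw [Matrix.mul_diagonal, Matrix.diagonal_mul, mul_comm]
    by_cases h : (Eᴴ * E) k l = 0
    · simp [h]
    · rw [hf' (hP k l h)]
  set F := Matrix.diagonal (fun k => (f k : ℂ)) with hF
  have hFs : Fᴴ = F := by
    rw [hF, Matrix.diagonal_conjTranspose]
    congr 1
    funext k
    simp
  have hH : (E * F * Eᴴ).IsHermitian := by
    simp [Matrix.IsHermitian, hFs, Matrix.mul_assoc]
  have hHE : Eᴴ * (E * F * Eᴴ) = F * Eᴴ := by
    rw [← Matrix.mul_assoc, ← Matrix.mul_assoc, ← hPf, Matrix.mul_assoc F, Matrix.mul_assoc Eᴴ, hE,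
      Matrix.mul_one]
  obtain ⟨U, h, hU, hs, -⟩ := exists_unitary_diagonal hH
  have hHU : E * F * Eᴴ * U = U * Matrix.diagonal (fun i => (h i : ℂ)) := by
    have : Uᴴ * U = 1 := Matrix.mem_unitaryGroup_iff'.1 hU
    rw [hs, Matrix.mul_assoc, this, Matrix.mul_one]
  set G := Eᴴ * U with hG
  have hEG : E * G = U := by rw [hG, ← Matrix.mul_assoc, hE, Matrix.one_mul]
  -- Column s of E†U is supported on indices with one common label, hence with one tuple of
  -- eigenvalues; any index in the support may then represent it.
  have hfG : ∀ k s, G k s ≠ 0 → (f k : ℂ) = h s := by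
    intro k s hk
    have h1 : F * G = G * Matrix.diagonal (fun i => (h i : ℂ)) := by
      rw [hG, ← Matrix.mul_assoc, ← hHE, Matrix.mul_assoc, hHU, Matrix.mul_assoc]
    have := congrFun₂ h1 k s
    rw [Matrix.mul_diagonal, Matrix.diagonal_mul, mul_comm] at this
    exact mul_left_cancel₀ hk this
  have hex : ∀ s, ∃ k, G k s ≠ 0 := by
    intro s
    by_contra! hk
    have h1 : ∀ i, U i s = 0 := by
      intro i
      rw [← hEG, Matrix.mul_apply]
      exact Finset.sum_eq_zero fun k _ => by rw [hk k, mul_zero]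
    have h2 : (Uᴴ * U) s s = 1 := by
      have : Uᴴ * U = 1 := Matrix.mem_unitaryGroup_iff'.1 hU
      rw [this, Matrix.one_apply_eq]
    rw [Matrix.mul_apply] at h2
    simp [h1] at h2
  choose g hg using hex
  refine ⟨U, fun m s => d m (g s), hU, fun m => ?_⟩
  have hDG : Matrix.diagonal (d m) * G = G * Matrix.diagonal (fun s => d m (g s)) := by
    ext k s
    rw [Matrix.mul_diagonal, Matrix.diagonal_mul, mul_comm]
    by_cases hk : G k s = 0
    · simp [hk]
    · have : f k = f (g s) := by
        have := (hfG k s hk).trans (hfG _ s (hg s)).symm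
        exact_mod_cast this
      exact congrArg (G k s * ·) (congrFun (hf this) m)
  rw [← hEG, ← Matrix.mul_assoc, hN, Matrix.mul_assoc, hDG, Matrix.mul_assoc E G]

/-! ### Sums of product projections -/

/-- The block of rows `(·, m)` of a matrix with rows indexed by the product basis. -/
def slice {a b : ℕ} {κ : Type*} (W : Matrix (Fin a × Fin b) κ ℂ) (m : Fin b) :
    Matrix (Fin a) κ ℂ :=
  Matrix.of fun i k => W (i, m) k

theorem slice_mul {a b : ℕ} {κ l : Type*} [Fintype κ] (W : Matrix (Fin a × Fin b) κ ℂ)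
    (E : Matrix κ l ℂ) (m : Fin b) : slice (W * E) m = slice W m * E := rfl

theorem traceB_mul_conjTranspose {a b : ℕ} {κ : Type*} [Fintype κ]
    (W : Matrix (Fin a × Fin b) κ ℂ) :
    traceB (W * Wᴴ) = ∑ m, slice W m * (slice W m)ᴴ := by
  ext i j
  rw [Matrix.sum_apply]
  rfl

/-- The matrix with columns `α_k ⊗ β_k`. -/
def prodCols {a b : ℕ} {κ : Type*} (α : κ → Fin a → ℂ) (β : κ → Fin b → ℂ) :
    Matrix (Fin a × Fin b) κ ℂ :=
  Matrix.of fun p k => α k p.1 * β k p.2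

theorem slice_prodCols {a b : ℕ} {κ : Type*} [Fintype κ] [DecidableEq κ] (α : κ → Fin a → ℂ)
    (β : κ → Fin b → ℂ) (m : Fin b) :
    slice (prodCols α β) m = (Matrix.of fun i k => α k i) * Matrix.diagonal (fun k => β k m) := by
  ext i k
  rw [Matrix.mul_diagonal]
  rfl

theorem prodCols_mul_conjTranspose {a b : ℕ} {κ : Type*} [Fintype κ] (α : κ → Fin a → ℂ)
    (β : κ → Fin b → ℂ) :
    prodCols α β * (prodCols α β)ᴴ = ∑ k, proj (α k) ⊗ₖ proj (β k) := by
  ext p q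
  rw [Matrix.mul_apply, Matrix.sum_apply]
  refine Finset.sum_congr rfl fun k _ => ?_
  simp only [prodCols, Matrix.of_apply, Matrix.conjTranspose_apply, Matrix.kroneckerMap_apply, proj,
    Matrix.vecMulVec_apply, Pi.star_apply, star_mul']
  ring

/-- A separable matrix of rank equal to the dimension of the first factor, with invertible
marginal: all its factorizations are by matrices with simultaneously diagonal slices. -/
theorem exists_slice_factorization {a b : ℕ} {κ : Type*} [Fintype κ]
    {W : Matrix (Fin a × Fin b) (Fin a) ℂ} {α : κ → Fin a → ℂ} {β : κ → Fin b → ℂ}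
    (hβ : ∀ k, β k ≠ 0) (hWZ : W * Wᴴ = ∑ k, proj (α k) ⊗ₖ proj (β k))
    (hW : IsUnit (Wᴴ * W).det) (htr : IsUnit (traceB (W * Wᴴ)).det) :
    ∃ (A : Matrix (Fin a) (Fin a) ℂ) (B : Fin a → Fin b → ℂ) (R : Matrix (Fin a) (Fin a) ℂ),
      R ∈ Matrix.unitaryGroup (Fin a) ℂ ∧
        ∀ m, slice W m = A * Matrix.diagonal (fun s => B s m) * R := by
  classical
  set Z := prodCols α β with hZ
  rw [← prodCols_mul_conjTranspose, ← hZ] at hWZ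
  set G := (Wᴴ * W)⁻¹ with hG
  have hGW : G * (Wᴴ * W) = 1 := Matrix.nonsing_inv_mul _ hW
  -- W G W† is the orthogonal projection onto the range of W, and this range contains the columns of
  -- Z because Z Z† = W W†.
  set E := G * Wᴴ * Z with hEdef
  have hWE : W * E = Z := by
    have h0 : (1 - W * G * Wᴴ) * (Z * Zᴴ) = 0 := by
      rw [← hWZ, Matrix.sub_mul, Matrix.one_mul, Matrix.mul_assoc, Matrix.mul_assoc W G,
        ← Matrix.mul_assoc Wᴴ, ← Matrix.mul_assoc G, hGW, Matrix.one_mul, sub_self]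
    rw [Matrix.mul_self_mul_conjTranspose_eq_zero, Matrix.sub_mul, Matrix.one_mul,
      sub_eq_zero] at h0
    rw [hEdef, ← Matrix.mul_assoc, ← Matrix.mul_assoc]
    exact h0.symm
  have hE : E * Eᴴ = 1 := by
    have : E * Eᴴ = G * (Wᴴ * W) * (G * (Wᴴ * W))ᴴ := by
      calc E * Eᴴ = G * Wᴴ * (Z * Zᴴ) * (G * Wᴴ)ᴴ := by
            rw [hEdef, Matrix.conjTranspose_mul]; simp only [Matrix.mul_assoc]
        _ = _ := by
            rw [← hWZ]
            simp only [Matrix.conjTranspose_mul, Matrix.conjTranspose_conjTranspose,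
              Matrix.mul_assoc]
    rw [this, hGW, Matrix.conjTranspose_one, Matrix.one_mul]
  -- One functional is nonzero on all the β_k, so the diagonal matrix of its values can be inverted.
  obtain ⟨f, hf⟩ := Module.exists_dual_forall_apply_ne_zero (K := ℂ) β hβ
  set x : Fin b → ℂ := fun m => f (Pi.single m 1) with hx
  have hfx : ∀ k, ∑ m, x m * β k m = f (β k) := by
    intro k
    conv_rhs => rw [pi_eq_sum_univ' (β k)]
    rw [map_sum]
    refine Finset.sum_congr rfl fun m _ => ?_
    rw [map_smul, smul_eq_mul, mul_comm, hx]
  set Az : Matrix (Fin a) κ ℂ := Matrix.of fun i k => α k i with hAz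
  have hsl : ∀ m, slice W m * E = Az * Matrix.diagonal (fun k => β k m) := fun m => by
    rw [← slice_mul, hWE, hZ, slice_prodCols]
  set Wx := ∑ m, x m • slice W m with hWx
  have hWxE : Wx * E = Az * Matrix.diagonal (fun k => f (β k)) := by
    rw [hWx, Matrix.sum_mul]
    simp only [Matrix.smul_mul, hsl]
    ext i k
    rw [Matrix.sum_apply, Matrix.mul_diagonal, ← hfx, Finset.mul_sum]
    refine Finset.sum_congr rfl fun m _ => ?_
    rw [Matrix.smul_apply, Matrix.mul_diagonal, smul_eq_mul]
    ring
  have hAzE : Az = Wx * (E * Matrix.diagonal (fun k => (f (β k))⁻¹)) := by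
    rw [← Matrix.mul_assoc, hWxE, Matrix.mul_assoc, Matrix.diagonal_mul_diagonal]
    simp [hf]
  -- W_x is a left factor of the marginal, which is invertible.
  have hWxdet : IsUnit Wx.det := by
    have h1 : traceB (W * Wᴴ) = Wx * (E * Matrix.diagonal (fun k => (f (β k))⁻¹) *
        ∑ m, Matrix.diagonal (fun k => β k m) * (slice Z m)ᴴ) := by
      rw [hWZ, traceB_mul_conjTranspose, ← Matrix.mul_assoc, ← hAzE, Matrix.mul_sum]
      refine Finset.sum_congr rfl fun m _ => ?_
      rw [← Matrix.mul_assoc, hAz, ← slice_prodCols]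
    rw [h1, Matrix.det_mul] at htr
    exact isUnit_of_mul_isUnit_left htr
  have hN : ∀ m, (Wx⁻¹ * slice W m) * E =
      E * Matrix.diagonal (fun k => (f (β k))⁻¹ * β k m) := by
    intro m
    rw [Matrix.mul_assoc, hsl, hAzE, Matrix.mul_assoc Wx, ← Matrix.mul_assoc Wx⁻¹,
      Matrix.nonsing_inv_mul _ hWxdet, Matrix.one_mul, Matrix.mul_assoc,
      Matrix.diagonal_mul_diagonal]
  obtain ⟨U, l, hU, hl⟩ := exists_unitary_diagonalizing hE hN
  refine ⟨Wx * U, fun s m => l m s, Uᴴ, ?_, fun m => ?_⟩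
  · rw [Matrix.mem_unitaryGroup_iff', Matrix.star_eq_conjTranspose,
      Matrix.conjTranspose_conjTranspose]
    exact Matrix.mem_unitaryGroup_iff.1 hU
  · have : U * Uᴴ = 1 := Matrix.mem_unitaryGroup_iff.1 hU
    rw [Matrix.mul_assoc Wx, ← hl m, ← Matrix.mul_assoc, ← Matrix.mul_assoc,
      Matrix.mul_nonsing_inv _ hWxdet, Matrix.one_mul, Matrix.mul_assoc, this, Matrix.mul_one]

/-- The cone generated by the product projections. -/
def sepCone (a b : ℕ) : AddSubmonoid (BiMat a b) :=
  AddSubmonoid.closure {τ | ∃ (α : Fin a → ℂ) (β : Fin b → ℂ), β ≠ 0 ∧ τ = proj α ⊗ₖ proj β}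

theorem proj_kronecker_proj_mem_sepCone {a b : ℕ} (α : Fin a → ℂ) (β : Fin b → ℂ) :
    proj α ⊗ₖ proj β ∈ sepCone a b := by
  by_cases h : β = 0
  · have : proj α ⊗ₖ proj β = 0 := by
      ext p q
      simp [h, proj, Matrix.vecMulVec_apply]
    rw [this]
    exact zero_mem _
  · exact AddSubmonoid.subset_closure ⟨α, β, h, rfl⟩

theorem exists_sum_of_mem_sepCone {a b : ℕ} {γ : BiMat a b} (h : γ ∈ sepCone a b) :
    ∃ (n : ℕ) (α : Fin n → Fin a → ℂ) (β : Fin n → Fin b → ℂ), (∀ k, β k ≠ 0) ∧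
      γ = ∑ k, proj (α k) ⊗ₖ proj (β k) := by
  obtain ⟨l, hl, hsum⟩ := AddSubmonoid.exists_list_of_mem_closure h
  have : ∀ k : Fin l.length, ∃ (α : Fin a → ℂ) (β : Fin b → ℂ), β ≠ 0 ∧
      l[k] = proj α ⊗ₖ proj β := fun k => hl _ (List.getElem_mem _)
  choose α β hβ hk using this
  refine ⟨l.length, α, β, hβ, ?_⟩
  rw [← hsum, ← Finset.sum_congr rfl fun k _ => hk k]
  exact (Fin.sum_univ_getElem l).symm

theorem mul_proj_mul_conjTranspose {m n : Type*} [Fintype n] (X : Matrix m n ℂ) (ψ : n → ℂ) :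
    X * proj ψ * Xᴴ = proj (X *ᵥ ψ) := by
  rw [proj, proj, Matrix.mul_vecMulVec, Matrix.vecMulVec_mul, Matrix.star_mulVec]

/-- Product operators send product vectors to product vectors. Rectangular X and Y are allowed, so
that compressions to a block are covered along with invertible filters and rescalings. -/
theorem kronecker_conj_mem_sepCone {a b a' b' : ℕ} {γ : BiMat a b} (h : γ ∈ sepCone a b)
    (X : Matrix (Fin a') (Fin a) ℂ) (Y : Matrix (Fin b') (Fin b) ℂ) :
    (X ⊗ₖ Y) * γ * (X ⊗ₖ Y)ᴴ ∈ sepCone a' b' := by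
  induction h using AddSubmonoid.closure_induction with
  | mem τ hτ =>
    obtain ⟨α, β, -, rfl⟩ := hτ
    rw [Matrix.conjTranspose_kronecker, ← Matrix.mul_kronecker_mul, ← Matrix.mul_kronecker_mul,
      mul_proj_mul_conjTranspose, mul_proj_mul_conjTranspose]
    exact proj_kronecker_proj_mem_sepCone _ _
  | zero =>
    rw [Matrix.mul_zero, Matrix.zero_mul]
    exact zero_mem _
  | add x y _ _ hx hy =>
    rw [Matrix.mul_add, Matrix.add_mul]
    exact add_mem hx hy

theorem smul_mem_sepCone {a b : ℕ} {γ : BiMat a b} (h : γ ∈ sepCone a b) {t : ℝ} (ht : 0 ≤ t) :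
    (t : ℂ) • γ ∈ sepCone a b := by
  have h1 := kronecker_conj_mem_sepCone h ((Real.sqrt t : ℂ) • (1 : Matrix (Fin a) (Fin a) ℂ))
    (1 : Matrix (Fin b) (Fin b) ℂ)
  have h2 : ((Real.sqrt t : ℝ) : ℂ) * (Real.sqrt t : ℝ) = (t : ℂ) := by
    rw [← Complex.ofReal_mul, Real.mul_self_sqrt ht]
  rw [Matrix.smul_kronecker, Matrix.one_kronecker_one, Matrix.conjTranspose_smul,
    Matrix.conjTranspose_one, Matrix.smul_mul, Matrix.one_mul, Matrix.mul_smul, Matrix.mul_one,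
    Complex.star_def, Complex.conj_ofReal, smul_smul, h2] at h1
  exact h1

theorem exists_sum_proj_of_posSemidef {n : Type*} [Fintype n] [DecidableEq n] {C : Matrix n n ℂ}
    (hC : C.PosSemidef) : ∃ ψ : Fin C.rank → n → ℂ, C = ∑ k, proj (ψ k) := by
  obtain ⟨K, hK⟩ := exists_rank_factorization hC rfl
  refine ⟨fun k i => K i k, ?_⟩
  ext i j
  rw [Matrix.sum_apply]
  nth_rw 1 [hK]
  rfl

theorem kronecker_mem_sepCone {a b : ℕ} {α : Matrix (Fin a) (Fin a) ℂ}
    {β : Matrix (Fin b) (Fin b) ℂ} (hα : α.PosSemidef) (hβ : β.PosSemidef) :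
    α ⊗ₖ β ∈ sepCone a b := by
  obtain ⟨ψ, hψ⟩ := exists_sum_proj_of_posSemidef hα
  obtain ⟨φ, hφ⟩ := exists_sum_proj_of_posSemidef hβ
  have : α ⊗ₖ β = ∑ k, ∑ l, proj (ψ k) ⊗ₖ proj (φ l) := by
    ext p q
    have h1 : α p.1 q.1 = ∑ k, proj (ψ k) p.1 q.1 := by
      rw [← Matrix.sum_apply]; exact congrFun₂ hψ _ _
    have h2 : β p.2 q.2 = ∑ k, proj (φ k) p.2 q.2 := by
      rw [← Matrix.sum_apply]; exact congrFun₂ hφ _ _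
    simp only [Matrix.sum_apply, Matrix.kroneckerMap_apply, h1, h2, Finset.sum_mul_sum]
  rw [this]
  exact sum_mem fun k _ => sum_mem fun l _ => proj_kronecker_proj_mem_sepCone _ _

/-- The cone forgets the normalization, which filters and compressions do not preserve. Proving
entanglement needs only this direction. -/
theorem IsSeparable.mem_sepCone {a b : ℕ} {γ : BiMat a b} (h : IsSeparable γ) :
    γ ∈ sepCone a b := by
  refine convexHull_min (t := (sepCone a b : Set (BiMat a b))) ?_ ?_ h
  · rintro τ ⟨α, β, hα, hβ, rfl⟩
    exact kronecker_mem_sepCone hα.1 hβ.1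
  · intro x hx y hy s t hs ht _
    have := add_mem (smul_mem_sepCone hx hs) (smul_mem_sepCone hy ht)
    simp only [Complex.coe_smul] at this
    exact this

/-- `adj(W_0) W_1` is normal if `W W†` is separable with full rank and marginal. -/
theorem commute_adjugate_mul_of_mem_sepCone {a b : ℕ} {W : Matrix (Fin a × Fin b) (Fin a) ℂ}
    (hsep : W * Wᴴ ∈ sepCone a b) (hW : IsUnit (Wᴴ * W).det)
    (htr : IsUnit (traceB (W * Wᴴ)).det) (m m' : Fin b) :
    (slice W m).adjugate * slice W m' * ((slice W m).adjugate * slice W m')ᴴ =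
      ((slice W m).adjugate * slice W m')ᴴ * ((slice W m).adjugate * slice W m') := by
  obtain ⟨n, α, β, hβ, h⟩ := exists_sum_of_mem_sepCone hsep
  obtain ⟨A, B, R, hR, hs⟩ := exists_slice_factorization hβ h hW htr
  have hRR : R * Rᴴ = 1 := Matrix.mem_unitaryGroup_iff.1 hR
  have hadj : R.adjugate = R.det • Rᴴ := by
    calc R.adjugate = R.adjugate * (R * Rᴴ) := by rw [hRR, Matrix.mul_one]
      _ = _ := by rw [← Matrix.mul_assoc, Matrix.adjugate_mul, Matrix.smul_mul, Matrix.one_mul]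
  set D := (Matrix.diagonal fun s => B s m).adjugate * Matrix.diagonal (fun s => B s m') with hD
  obtain ⟨d, hd⟩ : ∃ d, D = Matrix.diagonal d := by
    rw [hD, Matrix.adjugate_diagonal, Matrix.diagonal_mul_diagonal]
    exact ⟨_, rfl⟩
  -- The adjugate reverses products, so A cancels into det A and R survives on the outside as R†. It
  -- replaces the inverse because a single slice need not be invertible.
  have hM : (slice W m).adjugate * slice W m' = (R.det * A.det) • (Rᴴ * Matrix.diagonal d * R) := by
    rw [hs, hs, Matrix.adjugate_mul_distrib, Matrix.adjugate_mul_distrib, hadj, ← hd, hD]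
    calc _ = R.det • (Rᴴ * ((Matrix.diagonal fun s => B s m).adjugate * (A.adjugate * A) *
          Matrix.diagonal (fun s => B s m')) * R) := by
          simp only [Matrix.smul_mul, Matrix.mul_assoc]
      _ = _ := by
          rw [Matrix.adjugate_mul]
          simp only [Matrix.smul_mul, Matrix.mul_smul, Matrix.mul_one, smul_smul]
  have key : ∀ d d' : Fin a → ℂ, Rᴴ * Matrix.diagonal d * R * (Rᴴ * Matrix.diagonal d' * R) =
      Rᴴ * Matrix.diagonal (fun i => d i * d' i) * R := by
    intro d d'
    rw [← Matrix.diagonal_mul_diagonal]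
    calc _ = Rᴴ * Matrix.diagonal d * (R * Rᴴ) * Matrix.diagonal d' * R := by
          simp only [Matrix.mul_assoc]
      _ = _ := by rw [hRR, Matrix.mul_one, Matrix.mul_assoc Rᴴ]
  have hstar : (Rᴴ * Matrix.diagonal d * R)ᴴ = Rᴴ * Matrix.diagonal (star d) * R := by
    simp [Matrix.mul_assoc]
  rw [hM, Matrix.conjTranspose_smul, hstar]
  simp only [Matrix.smul_mul, Matrix.mul_smul, key, smul_smul, Pi.star_apply]
  congr 1
  · ring
  · simp only [mul_comm]

/-! ### Partial trace and local operators -/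

/-- The partial trace is dual to X ↦ X ⊗ 1. Tested against matrix units, this reduces identities for
`traceB` to cyclicity of the trace. -/
theorem trace_mul_kronecker_one {a b : ℕ} (γ : BiMat a b) (X : Matrix (Fin a) (Fin a) ℂ) :
    (γ * (X ⊗ₖ (1 : Matrix (Fin b) (Fin b) ℂ))).trace = (traceB γ * X).trace := by
  simp only [Matrix.trace, Matrix.diag_apply, Matrix.mul_apply, Fintype.sum_prod_type,
    Matrix.kroneckerMap_apply, traceB, Matrix.of_apply, Matrix.one_apply, Finset.sum_mul]
  refine Finset.sum_congr rfl fun i _ => ?_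
  rw [Finset.sum_comm]
  refine Finset.sum_congr rfl fun j _ => Finset.sum_congr rfl fun m _ => ?_
  simp

theorem trace_mul_single {n : Type*} [Fintype n] [DecidableEq n] (A : Matrix n n ℂ) (i j : n) :
    (A * Matrix.single j i 1).trace = A i j := by
  simp [Matrix.trace_mul_single]

theorem traceB_conj_kronecker {a b a' b' : ℕ} (γ : BiMat a b) (X : Matrix (Fin a') (Fin a) ℂ)
    {Y : Matrix (Fin b') (Fin b) ℂ} (hY : Yᴴ * Y = 1) :
    traceB ((X ⊗ₖ Y) * γ * (X ⊗ₖ Y)ᴴ) = X * traceB γ * Xᴴ := by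
  ext i j
  rw [← trace_mul_single (traceB _), ← trace_mul_kronecker_one,
    ← trace_mul_single (X * traceB γ * Xᴴ),
    Matrix.mul_assoc, Matrix.mul_assoc, Matrix.trace_mul_comm, Matrix.mul_assoc X,
    Matrix.mul_assoc X, Matrix.trace_mul_comm X, Matrix.mul_assoc (traceB γ),
    Matrix.mul_assoc (traceB γ), ← trace_mul_kronecker_one, Matrix.conjTranspose_kronecker,
    Matrix.mul_assoc, ← Matrix.mul_kronecker_mul, ← Matrix.mul_kronecker_mul, Matrix.mul_one, hY]

theorem trace_traceB {a b : ℕ} (γ : BiMat a b) : (traceB γ).trace = γ.trace := by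
  rw [← Matrix.mul_one (traceB γ), ← trace_mul_kronecker_one, Matrix.one_kronecker_one,
    Matrix.mul_one]

theorem traceB_add {a b : ℕ} (γ γ' : BiMat a b) : traceB (γ + γ') = traceB γ + traceB γ' := by
  ext i j
  simp [traceB, Finset.sum_add_distrib]

theorem traceB_smul {a b : ℕ} (c : ℂ) (γ : BiMat a b) : traceB (c • γ) = c • traceB γ := by
  ext i j
  simp [traceB, Finset.mul_sum]

theorem traceB_sum {a b : ℕ} {ι : Type*} (s : Finset ι) (γ : ι → BiMat a b) :
    traceB (∑ k ∈ s, γ k) = ∑ k ∈ s, traceB (γ k) := by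
  ext i j
  simp only [traceB, Matrix.of_apply, Matrix.sum_apply]
  exact Finset.sum_comm

theorem traceB_kronecker {a b : ℕ} (α : Matrix (Fin a) (Fin a) ℂ) (β : Matrix (Fin b) (Fin b) ℂ) :
    traceB (α ⊗ₖ β) = β.trace • α := by
  ext i j
  simp [traceB, Matrix.trace, Finset.mul_sum, mul_comm]

theorem rank_smul_of_ne_zero {m n : Type*} [Fintype n] [Fintype m] {c : ℂ} (hc : c ≠ 0)
    (A : Matrix m n ℂ) : (c • A).rank = A.rank :=
  Matrix.rank_smul_of_mem_nonZeroDivisors A (mem_nonZeroDivisors_of_ne_zero hc)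

theorem proj_smul {n : Type*} (c : ℂ) (ψ : n → ℂ) : proj (c • ψ) = (c * star c) • proj ψ := by
  ext i j
  simp only [proj, Matrix.vecMulVec_apply, Pi.smul_apply, Pi.star_apply, Matrix.smul_apply,
    smul_eq_mul, star_mul']
  ring

theorem trace_proj {n : Type*} [Fintype n] (ψ : n → ℂ) :
    (proj ψ).trace = ((∑ i, ‖ψ i‖ ^ 2 : ℝ) : ℂ) := by
  simp [proj, Matrix.trace, Matrix.vecMulVec_apply, Complex.mul_conj']

theorem trace_proj_sphere {b : ℕ} (ψ : Sphere b) :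
    (proj fun m => (ψ : EuclideanSpace ℂ (Fin b)) m).trace = 1 := by
  have h : ‖(ψ : EuclideanSpace ℂ (Fin b))‖ = 1 := mem_sphere_zero_iff_norm.1 ψ.2
  rw [trace_proj, ← EuclideanSpace.norm_sq_eq, h]
  simp

theorem sum_proj_col {m n : Type*} [Fintype n] (A : Matrix m n ℂ) :
    ∑ k, proj (fun i => A i k) = A * Aᴴ := by
  ext i j
  rw [Matrix.sum_apply]
  rfl

/-! ### Separable states with maximally mixed marginal -/

/-- `(1/a) ∑_k |g_k⟩⟨g_k| ⊗ |ψ_k⟩⟨ψ_k|`, with `g_k` the columns of `U`. -/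
def productState {a b : ℕ} (U : SU a) (ψ : Fin a → Sphere b) : BiMat a b :=
  (a : ℂ)⁻¹ • ∑ k, proj (fun i => (U : Matrix (Fin a) (Fin a) ℂ) i k) ⊗ₖ
    proj (fun m => (ψ k : EuclideanSpace ℂ (Fin b)) m)

/-- Multiplying the first column by the conjugate of the determinant, a phase, makes the determinant
1 and leaves every column projection unchanged. -/
theorem exists_specialUnitary_same_proj {a : ℕ} (ha : 0 < a) {U : Matrix (Fin a) (Fin a) ℂ}
    (hU : U ∈ Matrix.unitaryGroup (Fin a) ℂ) :
    ∃ S : SU a, ∀ k, proj (fun i => (S : Matrix (Fin a) (Fin a) ℂ) i k) =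
      proj (fun i => U i k) := by
  let z : Fin a → ℂ := fun k => if k = ⟨0, ha⟩ then star U.det else 1
  have hdet : U.det * star U.det = 1 := by
    have := congrArg Matrix.det (Matrix.mem_unitaryGroup_iff.1 hU)
    rwa [Matrix.det_mul, Matrix.star_eq_conjTranspose, Matrix.det_conjTranspose,
      Matrix.det_one] at this
  have hz : ∀ k, z k * star (z k) = 1 := by
    intro k
    by_cases h : k = ⟨0, ha⟩
    · simp only [z, h, if_true, star_star, mul_comm, hdet]
    · simp [z, h]
  have hprod : ∏ k, z k = star U.det := by
    simp [z]
  refine ⟨⟨U * Matrix.diagonal z, ?_⟩, fun k => ?_⟩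
  · rw [Matrix.mem_specialUnitaryGroup_iff]
    refine ⟨mul_mem hU ?_, ?_⟩
    · rw [Matrix.mem_unitaryGroup_iff, Matrix.star_eq_conjTranspose, Matrix.diagonal_conjTranspose,
        Matrix.diagonal_mul_diagonal, ← Matrix.diagonal_one]
      congr 1
      funext k
      exact hz k
    · rw [Matrix.det_mul, Matrix.det_diagonal, hprod, hdet]
  · have : (fun i => (U * Matrix.diagonal z) i k) = z k • fun i => U i k := by
      funext i
      rw [Matrix.mul_diagonal, Pi.smul_apply, smul_eq_mul, mul_comm]
    simp only [this, proj_smul, hz, one_smul]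

theorem isUnit_det_conjTranspose_mul_self {n : Type*} [Fintype n] [DecidableEq n] {a : ℕ}
    {W : Matrix n (Fin a) ℂ} (h : (W * Wᴴ).rank = a) : IsUnit (Wᴴ * W).det := by
  rw [isUnit_det_iff_rank, Matrix.rank_conjTranspose_mul_self, Fintype.card_fin,
    ← Matrix.rank_self_mul_conjTranspose, h]

theorem exists_productState_of_mem_sepCone {a b : ℕ} (ha : 0 < a) {γ : BiMat a b}
    (hγ : γ ∈ channelStates a b) (hsep : γ ∈ sepCone a b) :
    ∃ (U : SU a) (ψ : Fin a → Sphere b), γ = productState U ψ := by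
  obtain ⟨⟨⟨hpos, -⟩, hrank, hrankA⟩, htr⟩ := hγ
  obtain ⟨W, rfl⟩ := exists_rank_factorization hpos hrank
  obtain ⟨n, α, β, hβ, h⟩ := exists_sum_of_mem_sepCone hsep
  obtain ⟨A, B, R, hR, hs⟩ := exists_slice_factorization hβ h
    (isUnit_det_conjTranspose_mul_self hrank)
    (by rw [isUnit_det_iff_rank, hrankA, Fintype.card_fin])
  have hWR : W = prodCols (fun s i => A i s) B * R := by
    ext ⟨i, m⟩ r
    have := congrFun₂ (hs m) i r
    rw [show A = Matrix.of fun i s => A i s from rfl] at this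
    rw [← slice_prodCols (fun s i => A i s) B m] at this
    exact this
  have hRR : R * Rᴴ = 1 := Matrix.mem_unitaryGroup_iff.1 hR
  have hW : W * Wᴴ = ∑ s, proj (fun i => A i s) ⊗ₖ proj (B s) := by
    rw [← prodCols_mul_conjTranspose, hWR, Matrix.conjTranspose_mul, Matrix.mul_assoc,
      ← Matrix.mul_assoc R, hRR, Matrix.one_mul]
  let ν : Fin a → ℝ := fun s => Real.sqrt (∑ m, ‖B s m‖ ^ 2)
  have hν : ∀ s, (ν s : ℂ) * ν s = (proj (B s)).trace := by
    intro s
    rw [trace_proj, ← Complex.ofReal_mul, Real.mul_self_sqrt]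
    exact Finset.sum_nonneg fun _ _ => by positivity
  have hsq : ((Real.sqrt a : ℝ) : ℂ) * (Real.sqrt a : ℝ) = (a : ℂ) := by
    rw [← Complex.ofReal_mul, Real.mul_self_sqrt (Nat.cast_nonneg a)]
    simp
  have ha0 : (a : ℂ) ≠ 0 := by exact_mod_cast ha.ne'
  -- The norm of B_s and the factor 1/a are absorbed into the first factor, so that the marginal
  -- condition reads U U† = 1.
  set U : Matrix (Fin a) (Fin a) ℂ := Matrix.of fun i s => (Real.sqrt a * ν s : ℂ) * A i s with hUdef
  have hcol : ∀ s, proj (fun i => U i s) = ((a : ℂ) * (proj (B s)).trace) •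
      proj (fun i => A i s) := by
    intro s
    have : (fun i => U i s) = (Real.sqrt a * ν s : ℂ) • fun i => A i s := rfl
    rw [this, proj_smul, star_mul', Complex.star_def, Complex.conj_ofReal,
      Complex.conj_ofReal, ← hν, ← hsq]
    congr 1
    ring
  have hUU : U * Uᴴ = 1 := by
    rw [← sum_proj_col]
    simp only [hcol, mul_smul]
    rw [← Finset.smul_sum]
    simp only [← traceB_kronecker]
    rw [← traceB_sum, ← hW, htr, maxMixed, smul_smul, mul_inv_cancel₀ ha0, one_smul]
  have hU : U ∈ Matrix.unitaryGroup (Fin a) ℂ := Matrix.mem_unitaryGroup_iff.2 hUU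
  -- A vanishing B_s would give the unitary U a zero column; hence every B_s can be normalized.
  have hν0 : ∀ s, ν s ≠ 0 := by
    intro s h0
    have h1 : (Uᴴ * U) s s = 1 := by
      have : Uᴴ * U = 1 := Matrix.mem_unitaryGroup_iff'.1 hU
      rw [this, Matrix.one_apply_eq]
    rw [Matrix.mul_apply] at h1
    simp [hUdef, h0] at h1
  obtain ⟨S, hS⟩ := exists_specialUnitary_same_proj ha hU
  have hsphere : ∀ s, WithLp.toLp 2 (fun m => (ν s : ℂ)⁻¹ * B s m) ∈
      Metric.sphere (0 : EuclideanSpace ℂ (Fin b)) 1 := by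
    intro s
    have h1 : ν s ^ 2 = ∑ m, ‖B s m‖ ^ 2 :=
      Real.sq_sqrt (Finset.sum_nonneg fun _ _ => by positivity)
    rw [mem_sphere_zero_iff_norm, EuclideanSpace.norm_eq]
    simp only [norm_mul, norm_inv, Complex.norm_real, mul_pow, ← Finset.mul_sum]
    rw [← h1, Real.norm_eq_abs, inv_pow, sq_abs, inv_mul_cancel₀ (pow_ne_zero 2 (hν0 s)),
      Real.sqrt_one]
  refine ⟨S, fun s => ⟨_, hsphere s⟩, ?_⟩
  rw [hW, productState, Finset.smul_sum]
  refine Finset.sum_congr rfl fun s _ => ?_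
  rw [hS, hcol]
  change _ = (a : ℂ)⁻¹ • (_ ⊗ₖ proj ((ν s : ℂ)⁻¹ • B s))
  rw [proj_smul, Matrix.smul_kronecker, Matrix.kronecker_smul, smul_smul, smul_smul, ← hν,
    Complex.star_def, map_inv₀, Complex.conj_ofReal]
  have : (ν s : ℂ) ≠ 0 := by exact_mod_cast hν0 s
  rw [show (a : ℂ)⁻¹ * ((a : ℂ) * ((ν s : ℂ) * ν s)) * ((ν s : ℂ)⁻¹ * (ν s : ℂ)⁻¹) = 1 by
    field_simp, one_smul]

theorem productState_mem_sepCone {a b : ℕ} (U : SU a) (ψ : Fin a → Sphere b) :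
    productState U ψ ∈ sepCone a b := by
  have : ((a : ℂ)⁻¹) = (((a : ℝ)⁻¹ : ℝ) : ℂ) := by simp
  rw [productState, this]
  exact smul_mem_sepCone (sum_mem fun k _ => proj_kronecker_proj_mem_sepCone _ _) (by positivity)

/-! ### Block states -/

theorem sum_fin_eq_add_sum_tail {a : ℕ} (ha : 2 ≤ a) {M : Type*} [AddCommMonoid M]
    (F : Fin a → M) : ∑ k, F k = ∑ j : Fin 2, F (Fin.castLE ha j) + ∑ k : Tail a, F k := by
  rw [← Fintype.sum_subtype_add_sum_subtype (fun k : Fin a => 2 ≤ (k : ℕ)) F, add_comm]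
  congr 1
  let e : Fin 2 ≃ {k : Fin a // ¬ 2 ≤ (k : ℕ)} :=
    { toFun := fun j => ⟨Fin.castLE ha j, by simp; omega⟩
      invFun := fun k => ⟨k.1, by omega⟩
      left_inv := fun _ => rfl
      right_inv := fun _ => rfl }
  exact (Equiv.sum_comp e fun k => F k.1).symm

theorem mul_firstTwo_apply {a : ℕ} (ha : 2 ≤ a) {m : Type*} (A : Matrix m (Fin a) ℂ) (i : m)
    (j : Fin 2) : (A * firstTwo a) i j = A i (Fin.castLE ha j) := by
  rw [Matrix.mul_apply, Finset.sum_eq_single (Fin.castLE ha j)]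
  · simp [firstTwo]
  · intro k _ hk
    have : (k : ℕ) ≠ (j : ℕ) := fun h => hk (Fin.ext h)
    simp [firstTwo, this]
  · simp

theorem conjTranspose_mul_self_apply {a : ℕ} (U : SU a) (i j : Fin a) :
    ∑ k, star ((U : Matrix (Fin a) (Fin a) ℂ) k i) * (U : Matrix (Fin a) (Fin a) ℂ) k j =
      if i = j then 1 else 0 := by
  have h : (U : Matrix (Fin a) (Fin a) ℂ)ᴴ * (U : Matrix (Fin a) (Fin a) ℂ) = 1 :=
    Matrix.mem_unitaryGroup_iff'.1 (Matrix.specialUnitaryGroup_le_unitaryGroup U.2)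
  exact congrFun₂ h i j

theorem conjTranspose_firstTwo_mulVec_col {a : ℕ} (ha : 2 ≤ a) (U : SU a) (k : Tail a) :
    ((U : Matrix (Fin a) (Fin a) ℂ) * firstTwo a)ᴴ *ᵥ
      (fun i => (U : Matrix (Fin a) (Fin a) ℂ) i k.1) = 0 := by
  funext j
  simp only [Matrix.mulVec, dotProduct, Matrix.conjTranspose_apply, mul_firstTwo_apply ha]
  rw [conjTranspose_mul_self_apply, if_neg]
  · rfl
  · intro h
    have := congrArg Fin.val h
    have h2 := k.2
    simp at this
    omega

theorem isom_kronecker {a b : ℕ} (ha : 2 ≤ a) (U : SU a) (V : Isom2 b) :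
    (((U : Matrix (Fin a) (Fin a) ℂ) * firstTwo a) ⊗ₖ V.1)ᴴ *
      (((U : Matrix (Fin a) (Fin a) ℂ) * firstTwo a) ⊗ₖ V.1) = 1 := by
  rw [Matrix.conjTranspose_kronecker, ← Matrix.mul_kronecker_mul, V.2, firstTwo_isometry ha,
    Matrix.one_kronecker_one]

theorem norm_sq_sphere {b : ℕ} (ψ : Sphere b) :
    ∑ m, star ((ψ : EuclideanSpace ℂ (Fin b)) m) * (ψ : EuclideanSpace ℂ (Fin b)) m = 1 := by
  rw [← trace_proj_sphere ψ]
  simp only [Matrix.trace, proj, Matrix.diag_apply, Matrix.vecMulVec_apply, Pi.star_apply]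
  exact Finset.sum_congr rfl fun _ _ => mul_comm _ _

theorem prodCols_conjTranspose_mul {a b : ℕ} {κ κ' : Type*} (α : κ → Fin a → ℂ)
    (β : κ → Fin b → ℂ) (α' : κ' → Fin a → ℂ) (β' : κ' → Fin b → ℂ) (k : κ) (l : κ') :
    ((prodCols α β)ᴴ * prodCols α' β') k l =
      (∑ i, star (α k i) * α' l i) * ∑ m, star (β k m) * β' l m := by
  simp only [Matrix.mul_apply, Fintype.sum_prod_type, Finset.sum_mul_sum, prodCols, Matrix.of_apply,
    Matrix.conjTranspose_apply, star_mul']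
  exact Finset.sum_congr rfl fun _ _ => Finset.sum_congr rfl fun _ _ => by ring

theorem maxMixed_rank {a : ℕ} (ha : 0 < a) : (maxMixed a).rank = a := by
  have ha0 : (a : ℂ)⁻¹ ≠ 0 := inv_ne_zero (by exact_mod_cast ha.ne')
  rw [maxMixed, rank_smul_of_ne_zero ha0, Matrix.rank_one, Fintype.card_fin]

theorem maxMixed_trace {a : ℕ} (ha : 0 < a) : (maxMixed a).trace = 1 := by
  have ha0 : (a : ℂ) ≠ 0 := by exact_mod_cast ha.ne'
  rw [maxMixed, Matrix.trace_smul, Matrix.trace_one, Fintype.card_fin, smul_eq_mul,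
    inv_mul_cancel₀ ha0]

theorem smul_mem_channelStates {a b : ℕ} (ha : 0 < a) {γ : BiMat a b} (hpos : γ.PosSemidef)
    (hrank : γ.rank = a) (htr : traceB γ = 1) : (a : ℂ)⁻¹ • γ ∈ channelStates a b := by
  have ha0 : (a : ℂ)⁻¹ ≠ 0 := inv_ne_zero (by exact_mod_cast ha.ne')
  have h1 : traceB ((a : ℂ)⁻¹ • γ) = maxMixed a := by rw [traceB_smul, htr, maxMixed]
  refine ⟨⟨⟨hpos.smul ?_, ?_⟩, ?_, ?_⟩, h1⟩
  · positivity
  · rw [← trace_traceB, h1, maxMixed_trace ha]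
  · rw [rank_smul_of_ne_zero ha0, hrank]
  · rw [h1, maxMixed_rank ha]

theorem blockState_mem_channelStates {a b : ℕ} (ha : 2 ≤ a) {C : BiMat 2 2} (hC : C.PosSemidef)
    (hrank : C.rank = 2) (htr : traceB C = 1) (V : Isom2 b) (U : SU a) (ψ : Tail a → Sphere b) :
    blockState C V U ψ ∈ channelStates a b := by
  obtain ⟨K, hK⟩ := exists_rank_factorization hC hrank
  set L := ((U : Matrix (Fin a) (Fin a) ℂ) * firstTwo a) ⊗ₖ V.1 with hL
  have hLL : Lᴴ * L = 1 := isom_kronecker ha U V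
  set T : Matrix (Fin a × Fin b) (Tail a) ℂ :=
    prodCols (fun k i => (U : Matrix (Fin a) (Fin a) ℂ) i k.1)
      (fun k m => (ψ k : EuclideanSpace ℂ (Fin b)) m) with hT
  -- Up to 1/a, X is a factor of the state. The columns of T are orthonormal and orthogonal to the
  -- range of L, so X†X is block diagonal with blocks K†K and 1, and X has full column rank.
  set X := Matrix.fromCols (L * K) T with hX
  have hTT : Tᴴ * T = 1 := by
    ext k l
    rw [hT, prodCols_conjTranspose_mul, conjTranspose_mul_self_apply, Matrix.one_apply]
    by_cases h : k = l
    · subst h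
      rw [if_pos rfl, if_pos rfl, one_mul, norm_sq_sphere]
    · have : k.1 ≠ l.1 := fun h' => h (Subtype.ext h')
      simp [h, this]
  have hLT : Lᴴ * T = 0 := by
    ext ⟨j, m⟩ k
    have h1 := congrFun (conjTranspose_firstTwo_mulVec_col ha U k) j
    simp only [Matrix.mulVec, dotProduct, Pi.zero_apply] at h1
    rw [hL, hT, Matrix.conjTranspose_kronecker, Matrix.mul_apply, Fintype.sum_prod_type]
    simp only [Matrix.kroneckerMap_apply, prodCols, Matrix.of_apply, Matrix.zero_apply]
    calc _ = (∑ i, ((U : Matrix (Fin a) (Fin a) ℂ) * firstTwo a)ᴴ j i *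
          (U : Matrix (Fin a) (Fin a) ℂ) i k.1) *
          ∑ n, (V.1)ᴴ m n * (ψ k : EuclideanSpace ℂ (Fin b)) n := by
          rw [Finset.sum_mul_sum]
          exact Finset.sum_congr rfl fun _ _ => Finset.sum_congr rfl fun _ _ => by ring
      _ = 0 := by rw [h1, zero_mul]
  have hTL : Tᴴ * L = 0 := by
    rw [← Matrix.conjTranspose_conjTranspose (Tᴴ * L), Matrix.conjTranspose_mul,
      Matrix.conjTranspose_conjTranspose, hLT, Matrix.conjTranspose_zero]
  have hXX : blockState C V U ψ = (a : ℂ)⁻¹ • (X * Xᴴ) := by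
    rw [blockState, ← prodCols_mul_conjTranspose, hX,
      Matrix.conjTranspose_fromCols_eq_fromRows_conjTranspose, Matrix.fromCols_mul_fromRows, hK,
      ← hL, ← hT, Matrix.conjTranspose_mul]
    simp only [Matrix.mul_assoc]
  have hXdet : IsUnit (Xᴴ * X).det := by
    rw [hX, Matrix.conjTranspose_fromCols_eq_fromRows_conjTranspose, Matrix.fromRows_mul_fromCols,
      Matrix.conjTranspose_mul, Matrix.mul_assoc Kᴴ, ← Matrix.mul_assoc Lᴴ, hLL, Matrix.one_mul,
      Matrix.mul_assoc Kᴴ, hLT, Matrix.mul_zero, Matrix.det_fromBlocks_zero₁₂, hTT, Matrix.det_one,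
      mul_one]
    exact isUnit_det_conjTranspose_mul_self (by rw [← hK, hrank])
  rw [hXX]
  refine smul_mem_channelStates (by omega) (Matrix.posSemidef_self_mul_conjTranspose X) ?_ ?_
  · rw [isUnit_det_iff_rank, Matrix.rank_conjTranspose_mul_self] at hXdet
    rw [Matrix.rank_self_mul_conjTranspose, hXdet]
    have h1 := sum_fin_eq_add_sum_tail ha (fun _ => 1)
    simpa using h1.symm
  · have h1 : X * Xᴴ = L * C * Lᴴ + ∑ k : Tail a,
        proj (fun i => (U : Matrix (Fin a) (Fin a) ℂ) i k.1) ⊗ₖ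
          proj (fun m => (ψ k : EuclideanSpace ℂ (Fin b)) m) := by
      have ha0 : (a : ℂ)⁻¹ ≠ 0 := inv_ne_zero (by exact_mod_cast (by omega : a ≠ 0))
      exact (smul_right_injective _ ha0 hXX).symm
    have h2 : (U : Matrix (Fin a) (Fin a) ℂ) * (U : Matrix (Fin a) (Fin a) ℂ)ᴴ = 1 :=
      Matrix.mem_unitaryGroup_iff.1 (Matrix.specialUnitaryGroup_le_unitaryGroup U.2)
    rw [h1, traceB_add, hL, traceB_conj_kronecker _ _ V.2, htr, Matrix.mul_one, traceB_sum, ← h2,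
      ← sum_proj_col, ← sum_proj_col, sum_fin_eq_add_sum_tail ha]
    congr 1
    · simp only [mul_firstTwo_apply ha]
    · refine Finset.sum_congr rfl fun k _ => ?_
      rw [traceB_kronecker, trace_proj_sphere, one_smul]

theorem exists_isom_range {b : ℕ} (hb : 2 ≤ b) (ψ : Fin 2 → Sphere b) :
    ∃ (V : Isom2 b) (c : Fin 2 → Fin 2 → ℂ),
      ∀ j, V.1 *ᵥ c j = fun m => (ψ j : EuclideanSpace ℂ (Fin b)) m := by
  set x : EuclideanSpace ℂ (Fin b) := (ψ 0).1 with hx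
  set y : EuclideanSpace ℂ (Fin b) := (ψ 1).1 with hy
  have hx1 : ‖x‖ = 1 := mem_sphere_zero_iff_norm.1 (ψ 0).2
  have hxx : inner ℂ x x = 1 := by rw [inner_self_eq_norm_sq_to_K, hx1]; simp
  have hz : ∃ z : EuclideanSpace ℂ (Fin b), z ≠ 0 ∧ inner ℂ x z = 0 ∧
      ∃ c d : ℂ, y = c • x + d • z := by
    -- Gram–Schmidt gives no second vector when the two are parallel; any nonzero vector orthogonal
    -- to x then serves, and b ≥ 2 provides one.
    by_cases hr : y - inner ℂ x y • x = 0
    · have hne : (ℂ ∙ x)ᗮ ≠ ⊥ := by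
        rw [Ne, Submodule.orthogonal_eq_bot_iff]
        intro h
        have h1 := finrank_span_singleton (K := ℂ) (v := x) (by rintro h0; simp [h0] at hx1)
        rw [h, finrank_top, finrank_euclideanSpace, Fintype.card_fin] at h1
        omega
      obtain ⟨z, hz, hz0⟩ := Submodule.exists_mem_ne_zero_of_ne_bot hne
      refine ⟨z, hz0, Submodule.mem_orthogonal_singleton_iff_inner_right.1 hz, inner ℂ x y, 0, ?_⟩
      rw [zero_smul, add_zero]
      exact sub_eq_zero.1 hr
    · refine ⟨_, hr, ?_, inner ℂ x y, 1, by simp⟩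
      rw [inner_sub_right, inner_smul_right, hxx, mul_one, sub_self]
  obtain ⟨z, hz0, hxz, c, d, hyz⟩ := hz
  set w := (‖z‖⁻¹ : ℂ) • z with hw
  have hzn : (‖z‖ : ℂ) ≠ 0 := by simpa using hz0
  have hw1 : ‖w‖ = 1 := by
    rw [hw, norm_smul, norm_inv, Complex.norm_real, norm_norm,
      inv_mul_cancel₀ (norm_ne_zero_iff.2 hz0)]
  have hww : inner ℂ w w = 1 := by rw [inner_self_eq_norm_sq_to_K, hw1]; simp
  have hxw : inner ℂ x w = 0 := by rw [hw, inner_smul_right, hxz, mul_zero]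
  have hwx : inner ℂ w x = 0 := by rw [← inner_conj_symm, hxw, map_zero]
  have hyw : y = c • x + (d * ‖z‖) • w := by
    rw [hw, smul_smul, mul_assoc, mul_inv_cancel₀ hzn, mul_one, hyz]
  have hin : ∀ p q : EuclideanSpace ℂ (Fin b), ∑ m, star (p m) * q m = inner ℂ p q := by
    intro p q
    simp [PiLp.inner_apply, mul_comm]
  let g : Fin 2 → EuclideanSpace ℂ (Fin b) := ![x, w]
  refine ⟨⟨Matrix.of fun m j => g j m, ?_⟩, ![![1, 0], ![c, d * ‖z‖]], ?_⟩
  · ext i j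
    have : ((Matrix.of fun m j => g j m : Matrix (Fin b) (Fin 2) ℂ)ᴴ *
        (Matrix.of fun m j => g j m)) i j = inner ℂ (g i) (g j) := by
      rw [← hin]; rfl
    rw [this]
    fin_cases i <;> fin_cases j <;> simp [g, hx1, hw1, hxw, hwx]
  · intro j
    funext m
    fin_cases j
    · simp [Matrix.mulVec, dotProduct, g, hx]
    · simp only [Fin.mk_one, ← hy, hyw]
      simp [Matrix.mulVec, dotProduct, g, mul_comm]

/-- An isometry whose range contains the first two ψ_j pulls the first two product terms back to C =
∑ |e_j⟩⟨e_j| ⊗ |c_j⟩⟨c_j|. This places the product states in 𝒴, where ω is prescribed. -/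
theorem exists_blockState_eq_productState {a b : ℕ} (ha : 2 ≤ a) (hb : 2 ≤ b) (U : SU a)
    (ψ : Fin a → Sphere b) :
    ∃ (C : BiMat 2 2) (V : Isom2 b), C.PosSemidef ∧ C.rank = 2 ∧ traceB C = 1 ∧
      productState U ψ = blockState C V U (fun k => ψ k.1) := by
  obtain ⟨V, c, hc⟩ := exists_isom_range hb (fun j => ψ (Fin.castLE ha j))
  have hcn : ∀ j, (proj (c j)).trace = 1 := by
    intro j
    have h1 := congrArg Matrix.trace (mul_proj_mul_conjTranspose V.1 (c j))
    rw [hc, trace_proj_sphere, Matrix.trace_mul_comm, ← Matrix.mul_assoc, V.2,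
      Matrix.one_mul] at h1
    exact h1
  set K : Matrix (Fin 2 × Fin 2) (Fin 2) ℂ := prodCols (fun j => Pi.single j 1) c with hK
  have hKK : K * Kᴴ = ∑ j, proj (Pi.single j 1) ⊗ₖ proj (c j) := prodCols_mul_conjTranspose _ _
  refine ⟨K * Kᴴ, V, Matrix.posSemidef_self_mul_conjTranspose K, ?_, ?_, ?_⟩
  · have h1 : Kᴴ * K = 1 := by
      ext i j
      rw [hK, prodCols_conjTranspose_mul, Matrix.one_apply]
      by_cases h : i = j
      · subst h
        have h2 := hcn i
        simp only [Matrix.trace, proj, Matrix.diag_apply, Matrix.vecMulVec_apply,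
          Pi.star_apply] at h2
        have h3 : ∑ m, star (c i m) * c i m = 1 := by
          rw [← h2]
          exact Finset.sum_congr rfl fun _ _ => mul_comm _ _
        rw [h3]
        simp [Pi.single_apply]
      · simp [h, Pi.single_apply, Ne.symm h]
    rw [Matrix.rank_self_mul_conjTranspose, ← Matrix.rank_conjTranspose_mul_self, h1,
      Matrix.rank_one, Fintype.card_fin]
  · rw [hKK, traceB_sum]
    simp only [traceB_kronecker, hcn, one_smul]
    ext i j
    fin_cases i <;> fin_cases j <;> simp [proj, Matrix.vecMulVec_apply]
  · rw [productState, blockState, hKK, sum_fin_eq_add_sum_tail ha, Matrix.mul_sum, Matrix.sum_mul]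
    congr 2
    refine Finset.sum_congr rfl fun j _ => ?_
    rw [Matrix.conjTranspose_kronecker, ← Matrix.mul_kronecker_mul, ← Matrix.mul_kronecker_mul,
      mul_proj_mul_conjTranspose, mul_proj_mul_conjTranspose, hc]
    congr 2
    funext i
    rw [Matrix.mulVec_single_one, Matrix.col_apply, mul_firstTwo_apply ha]

theorem productState_mem_blockStates {a b : ℕ} (ha : 2 ≤ a) (hb : 2 ≤ b) (U : SU a)
    (ψ : Fin a → Sphere b) : productState U ψ ∈ blockStates a b := by
  obtain ⟨C, V, hC, hr, ht, h⟩ := exists_blockState_eq_productState ha hb U ψ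
  exact ⟨h ▸ blockState_mem_channelStates ha hC hr ht V U _, C, V, U, _, hC, hr, ht, h⟩

/-- Compressing by (g_1, g_2)† ⊗ V† kills the tail, whose g_k are orthogonal to g_1 and g_2, and
returns C. -/
theorem mem_sepCone_of_blockState {a b : ℕ} (ha : 2 ≤ a) {C : BiMat 2 2} {V : Isom2 b} {U : SU a}
    {ψ : Tail a → Sphere b} (h : blockState C V U ψ ∈ sepCone a b) : C ∈ sepCone 2 2 := by
  have ha0 : (a : ℂ) ≠ 0 := by exact_mod_cast (by omega : a ≠ 0)
  have h1 := smul_mem_sepCone h (Nat.cast_nonneg (α := ℝ) a)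
  rw [blockState, Complex.ofReal_natCast, smul_smul, mul_inv_cancel₀ ha0, one_smul] at h1
  have h2 := kronecker_conj_mem_sepCone h1 ((U : Matrix (Fin a) (Fin a) ℂ) * firstTwo a)ᴴ (V.1)ᴴ
  have h3 : ∀ k : Tail a, (((U : Matrix (Fin a) (Fin a) ℂ) * firstTwo a) ⊗ₖ V.1)ᴴ *
      (proj (fun i => (U : Matrix (Fin a) (Fin a) ℂ) i k.1) ⊗ₖ
          proj (fun m => (ψ k : EuclideanSpace ℂ (Fin b)) m)) = 0 := by
    intro k
    rw [Matrix.conjTranspose_kronecker, ← Matrix.mul_kronecker_mul, proj, Matrix.mul_vecMulVec,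
      conjTranspose_firstTwo_mulVec_col ha]
    ext p q
    simp
  rw [← Matrix.conjTranspose_kronecker, Matrix.mul_add, Matrix.mul_sum,
    Finset.sum_eq_zero fun k _ => h3 k, add_zero, Matrix.conjTranspose_conjTranspose] at h2
  have hL := isom_kronecker ha U V
  generalize ((U : Matrix (Fin a) (Fin a) ℂ) * firstTwo a) ⊗ₖ V.1 = L at hL h2
  have h4 : Lᴴ * (L * C * Lᴴ) * L = Lᴴ * L * C * (Lᴴ * L) := by simp only [Matrix.mul_assoc]
  rwa [h4, hL, Matrix.one_mul, Matrix.mul_one] at h2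

/-! ### The qubit channels -/

/-- The two Kraus vectors of the channel with parameters `(p + q, q - p)`. -/
def qubitKraus (p q : ℝ) : Matrix (Fin 2 × Fin 2) (Fin 2) ℂ :=
  Matrix.of fun i r =>
    (!![(Real.cos p : ℂ), 0; 0, (Real.sin p : ℂ)] : Matrix (Fin 2) (Fin 2) ℂ) i.2 r *
        (if i.1 = 0 then 1 else 0) +
      (!![0, -(Real.sin q : ℂ); (Real.cos q : ℂ), 0] : Matrix (Fin 2) (Fin 2) ℂ) i.2 r *
        (if i.1 = 1 then 1 else 0)

theorem qubitChoi_apply (u v : ℝ) (i j m n : Fin 2) :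
    qubitChoi u v (i, m) (j, n) = qubitChannel u v (Matrix.single i j 1) m n := by
  simp only [qubitChoi, Matrix.sum_apply, Matrix.kroneckerMap_apply, Matrix.single_apply]
  rw [Finset.sum_eq_single i, Finset.sum_eq_single j]
  · simp
  · intro k _ hk
    simp [hk]
  · simp
  · intro k _ hk
    simp [hk]
  · simp

theorem qubitChannel_eq (u v : ℝ) (X : Matrix (Fin 2) (Fin 2) ℂ) :
    qubitChannel u v X =
      !![(X 0 0 + X 1 1) / 2 * (1 + Real.sin u * Real.sin v) +
          (X 0 0 - X 1 1) / 2 * (Real.cos u * Real.cos v),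
        (X 0 1 + X 1 0) / 2 * Real.cos u + (X 0 1 - X 1 0) / 2 * Real.cos v;
        (X 0 1 + X 1 0) / 2 * Real.cos u - (X 0 1 - X 1 0) / 2 * Real.cos v,
        (X 0 0 + X 1 1) / 2 * (1 - Real.sin u * Real.sin v) -
          (X 0 0 - X 1 1) / 2 * (Real.cos u * Real.cos v)] := by
  rw [Matrix.eta_fin_two X]
  generalize X 0 0 = x00
  generalize X 0 1 = x01
  generalize X 1 0 = x10
  generalize X 1 1 = x11
  simp only [qubitChannel, Fin.sum_univ_four, blochMatrix, pauli]
  generalize Real.cos u = cu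
  generalize Real.cos v = cv
  generalize Real.sin u = su
  generalize Real.sin v = sv
  ext m n
  fin_cases m <;> fin_cases n <;>
    simp [Matrix.trace, Fin.sum_univ_two]
  all_goals (ring_nf; try simp only [Complex.I_sq]; try ring_nf)

/-- In the angles p = (u - v)/2 and q = (u + v)/2 the channel has two Kraus operators: diag(cos p,
cos q), and the antidiagonal one with entries -sin q and sin p. -/
theorem qubitChoi_eq (p q : ℝ) :
    qubitChoi (p + q) (q - p) = qubitKraus p q * (qubitKraus p q)ᴴ := by
  have hp : (Real.cos p : ℂ) ^ 2 + (Real.sin p : ℂ) ^ 2 = 1 := by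
    exact_mod_cast Real.cos_sq_add_sin_sq p
  have hq : (Real.cos q : ℂ) ^ 2 + (Real.sin q : ℂ) ^ 2 = 1 := by
    exact_mod_cast Real.cos_sq_add_sin_sq q
  ext ⟨i, m⟩ ⟨j, n⟩
  rw [qubitChoi_apply, qubitChannel_eq, Matrix.mul_apply]
  simp only [Fin.sum_univ_two, Real.cos_add, Real.sin_add, Real.cos_sub, Real.sin_sub, qubitKraus,
    Matrix.conjTranspose_apply, Complex.ofReal_add, Complex.ofReal_sub, Complex.ofReal_mul,
    Matrix.of_apply]
  generalize Real.cos p = cp at *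
  generalize Real.cos q = cq at *
  generalize Real.sin p = sp at *
  generalize Real.sin q = sq at *
  fin_cases i <;> fin_cases j <;> fin_cases m <;> fin_cases n <;>
    simp
  · linear_combination ((cp : ℂ) ^ 2 - (sp : ℂ) ^ 2) / 2 * hq - hp / 2
  · linear_combination -((cp : ℂ) ^ 2 - (sp : ℂ) ^ 2) / 2 * hq - hp / 2
  · ring
  · ring
  · ring
  · ring
  · linear_combination ((sq : ℂ) ^ 2 - (cq : ℂ) ^ 2) / 2 * hp - hq / 2
  · linear_combination -((sq : ℂ) ^ 2 - (cq : ℂ) ^ 2) / 2 * hp - hq / 2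

theorem qubitKraus_conjTranspose_mul_self (p q : ℝ) :
    (qubitKraus p q)ᴴ * qubitKraus p q = Matrix.diagonal
      ![((Real.cos p ^ 2 + Real.cos q ^ 2 : ℝ) : ℂ), ((Real.sin p ^ 2 + Real.sin q ^ 2 : ℝ) : ℂ)] := by
  ext i j
  rw [Matrix.mul_apply]
  simp only [Fintype.sum_prod_type, Fin.sum_univ_two, qubitKraus, Matrix.conjTranspose_apply,
    Matrix.of_apply]
  generalize Real.cos p = cp at *
  generalize Real.cos q = cq at *
  generalize Real.sin p = sp at *
  generalize Real.sin q = sq at *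
  fin_cases i <;> fin_cases j <;> simp <;> ring

theorem traceB_qubitKraus (p q : ℝ) : traceB (qubitKraus p q * (qubitKraus p q)ᴴ) = 1 := by
  have hp : (Real.cos p : ℂ) ^ 2 + (Real.sin p : ℂ) ^ 2 = 1 := by
    exact_mod_cast Real.cos_sq_add_sin_sq p
  have hq : (Real.cos q : ℂ) ^ 2 + (Real.sin q : ℂ) ^ 2 = 1 := by
    exact_mod_cast Real.cos_sq_add_sin_sq q
  ext i j
  simp only [traceB, Matrix.of_apply, Matrix.mul_apply, Fin.sum_univ_two, qubitKraus,
    Matrix.conjTranspose_apply]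
  generalize Real.cos p = cp at *
  generalize Real.cos q = cq at *
  generalize Real.sin p = sp at *
  generalize Real.sin q = sq at *
  fin_cases i <;> fin_cases j <;> simp
  · linear_combination hp
  · linear_combination hq

/-- Here adj(W_0) W_1 is antidiagonal, so normality means sin²p sin²q = cos²p cos²q, and cos²p cos²q
- sin²p sin²q factors as cos(p + q) cos(q - p). -/
theorem cos_mul_cos_eq_zero_of_qubitKraus_mem_sepCone {p q : ℝ}
    (hdet : IsUnit ((qubitKraus p q)ᴴ * qubitKraus p q).det)
    (h : qubitKraus p q * (qubitKraus p q)ᴴ ∈ sepCone 2 2) :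
    Real.cos (p + q) * Real.cos (q - p) = 0 := by
  have htr : IsUnit (traceB (qubitKraus p q * (qubitKraus p q)ᴴ)).det := by
    rw [traceB_qubitKraus, Matrix.det_one]
    exact isUnit_one
  have h0 := congrFun₂ (commute_adjugate_mul_of_mem_sepCone h hdet htr 0 1) 0 0
  have hM : (slice (qubitKraus p q) 0).adjugate * slice (qubitKraus p q) 1 =
      !![0, -((Real.sin q : ℂ) * Real.sin p); (Real.cos p : ℂ) * Real.cos q, 0] := by
    have h1 : slice (qubitKraus p q) 0 = !![(Real.cos p : ℂ), 0; 0, -(Real.sin q : ℂ)] := by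
      ext i j
      fin_cases i <;> fin_cases j <;> simp [slice, qubitKraus]
    have h2 : slice (qubitKraus p q) 1 = !![0, (Real.sin p : ℂ); (Real.cos q : ℂ), 0] := by
      ext i j
      fin_cases i <;> fin_cases j <;> simp [slice, qubitKraus]
    rw [h1, h2, Matrix.adjugate_fin_two_of, Matrix.mul_fin_two]
    simp
  rw [hM] at h0
  have h1 : Real.sin q * Real.sin p * (Real.sin q * Real.sin p) =
      Real.cos p * Real.cos q * (Real.cos p * Real.cos q) := by
    simp only [Matrix.mul_apply, Fin.sum_univ_two, Matrix.conjTranspose_apply] at h0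
    simp [-Complex.ofReal_cos, -Complex.ofReal_sin] at h0
    exact_mod_cast h0
  rw [Real.cos_add, Real.cos_sub]
  linear_combination -h1

theorem qubitChoi_properties {u v : ℝ} (hu : u ∈ Set.Ioo 0 (Real.pi / 2))
    (hv : v ∈ Set.Ioo 0 (Real.pi / 2)) :
    (qubitChoi u v).PosSemidef ∧ (qubitChoi u v).rank = 2 ∧ traceB (qubitChoi u v) = 1 ∧
      qubitChoi u v ∉ sepCone 2 2 := by
  obtain ⟨p, q, rfl, rfl⟩ : ∃ p q, u = p + q ∧ v = q - p :=
    ⟨(u - v) / 2, (u + v) / 2, by ring, by ring⟩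
  obtain ⟨hu0, hu1⟩ := hu
  obtain ⟨hv0, hv1⟩ := hv
  -- In the open square |p| < π/4 and 0 < q < π/2, so both Kraus vectors are nonzero. The rank does
  -- drop to one at the excluded corner u = v = 0.
  have hcp : 0 < Real.cos p := Real.cos_pos_of_mem_Ioo ⟨by linarith, by linarith⟩
  have hsq : 0 < Real.sin q := Real.sin_pos_of_pos_of_lt_pi (by linarith) (by linarith)
  have hdet : IsUnit ((qubitKraus p q)ᴴ * qubitKraus p q).det := by
    rw [qubitKraus_conjTranspose_mul_self, Matrix.det_diagonal, Fin.prod_univ_two, isUnit_iff_ne_zero]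
    have h1 : Real.cos p ^ 2 + Real.cos q ^ 2 ≠ 0 := by positivity
    have h2 : Real.sin p ^ 2 + Real.sin q ^ 2 ≠ 0 := by positivity
    exact mul_ne_zero (Complex.ofReal_ne_zero.2 h1) (Complex.ofReal_ne_zero.2 h2)
  rw [qubitChoi_eq]
  refine ⟨Matrix.posSemidef_self_mul_conjTranspose _, ?_, traceB_qubitKraus p q, fun h => ?_⟩
  · rw [isUnit_det_iff_rank, Matrix.rank_conjTranspose_mul_self] at hdet
    rw [Matrix.rank_self_mul_conjTranspose, hdet, Fintype.card_fin]
  · have h1 : 0 < Real.cos (p + q) := Real.cos_pos_of_mem_Ioo ⟨by linarith, hu1⟩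
    have h2 : 0 < Real.cos (q - p) := Real.cos_pos_of_mem_Ioo ⟨by linarith, hv1⟩
    exact (mul_pos h1 h2).ne' (cos_mul_cos_eq_zero_of_qubitKraus_mem_sepCone hdet h)

theorem paramState_mem_channelStates {a b : ℕ} (ha : 2 ≤ a) {x : Param a b}
    (hx : x.1 ∈ Set.Ioo 0 (Real.pi / 2) ×ˢ Set.Ioo 0 (Real.pi / 2)) :
    paramState x ∈ channelStates a b := by
  obtain ⟨h1, h2, h3, -⟩ := qubitChoi_properties hx.1 hx.2
  exact blockState_mem_channelStates ha h1 h2 h3 _ _ _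

theorem paramState_notMem_sepCone {a b : ℕ} (ha : 2 ≤ a) {x : Param a b}
    (hx : x.1 ∈ Set.Ioo 0 (Real.pi / 2) ×ˢ Set.Ioo 0 (Real.pi / 2)) :
    paramState x ∉ sepCone a b :=
  fun h => (qubitChoi_properties hx.1 hx.2).2.2.2 (mem_sepCone_of_blockState ha h)

/-! ### Local filtering -/

/-- The square of the filter is aρ, which turns the marginal I/a into ρ. The inverse filter would
carry a separable image back into the cone, contrary to the choice of γ. -/
theorem withMarginal_mem_and_isEntangled {a b : ℕ} {γ : BiMat a b}
    {ρ : Matrix (Fin a) (Fin a) ℂ} (ha : 0 < a) (hγ : γ ∈ channelStates a b)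
    (hsep : γ ∉ sepCone a b) (hρ : ρ.PosSemidef) (hdet : ρ.det ≠ 0) (htr : ρ.trace = 1) :
    withMarginal (γ, ρ) ∈ statesOfRank a b a a ∧ IsEntangled (withMarginal (γ, ρ)) := by
  have ha0 : (a : ℂ) ≠ 0 := by exact_mod_cast ha.ne'
  have hpos : ((a : ℝ) • ρ).PosSemidef := by
    rw [← Complex.coe_smul]
    exact hρ.smul (by simp)
  have hR : (cfc Real.sqrt ((a : ℝ) • ρ))ᴴ = cfc Real.sqrt ((a : ℝ) • ρ) :=
    cfc_predicate (p := IsSelfAdjoint) Real.sqrt ((a : ℝ) • ρ)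
  have hRR : cfc Real.sqrt ((a : ℝ) • ρ) * cfc Real.sqrt ((a : ℝ) • ρ) = (a : ℂ) • ρ := by
    have hsa : IsSelfAdjoint ((a : ℝ) • ρ) := hpos.1
    rw [← cfc_mul (fun x => Real.sqrt x) (fun x => Real.sqrt x)]
    have h1 : Set.EqOn (fun x => Real.sqrt x * Real.sqrt x) id (spectrum ℝ ((a : ℝ) • ρ)) := by
      intro x hx
      rw [hpos.1.spectrum_real_eq_range_eigenvalues] at hx
      obtain ⟨i, rfl⟩ := hx
      exact Real.mul_self_sqrt (hpos.eigenvalues_nonneg i)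
    rw [cfc_congr h1, cfc_id ℝ ((a : ℝ) • ρ), ← Complex.coe_smul]
    simp
  simp only [withMarginal]
  generalize cfc Real.sqrt ((a : ℝ) • ρ) = R at hR hRR
  have hRdet : IsUnit R.det := by
    have h1 := congrArg Matrix.det hRR
    rw [Matrix.det_mul, Matrix.det_smul] at h1
    rw [isUnit_iff_ne_zero]
    intro h0
    rw [h0, zero_mul] at h1
    exact mul_ne_zero (pow_ne_zero _ ha0) hdet h1.symm
  set M := R ⊗ₖ (1 : Matrix (Fin b) (Fin b) ℂ) with hM
  have hMs : Mᴴ = M := by rw [hM, Matrix.conjTranspose_kronecker, hR, Matrix.conjTranspose_one]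
  have hMdet : IsUnit M.det := by
    rw [hM, Matrix.det_kronecker, Matrix.det_one, one_pow, mul_one]
    exact hRdet.pow _
  obtain ⟨⟨⟨hγpos, -⟩, hrank, -⟩, htrB⟩ := hγ
  have h1 : traceB (M * γ * M) = ρ := by
    have := traceB_conj_kronecker γ R (Y := (1 : Matrix (Fin b) (Fin b) ℂ)) (by simp)
    rw [← hM, hMs, htrB, maxMixed, hR, Matrix.mul_smul, Matrix.mul_one, Matrix.smul_mul, hRR,
      smul_smul, inv_mul_cancel₀ ha0, one_smul] at this
    exact this
  have hstate : IsState (M * γ * M) := by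
    refine ⟨?_, by rw [← trace_traceB, h1, htr]⟩
    have := hγpos.mul_mul_conjTranspose_same M
    rwa [hMs] at this
  refine ⟨⟨hstate, ?_, ?_⟩, hstate, fun hs => hsep ?_⟩
  · rw [Matrix.rank_mul_eq_left_of_isUnit_det _ _ hMdet,
      Matrix.rank_mul_eq_right_of_isUnit_det _ _ hMdet, hrank]
  · rw [h1, (isUnit_det_iff_rank ρ).1 (isUnit_iff_ne_zero.2 hdet), Fintype.card_fin]
  · have h2 := kronecker_conj_mem_sepCone hs.mem_sepCone R⁻¹ (1 : Matrix (Fin b) (Fin b) ℂ)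
    have h3 : (R⁻¹ ⊗ₖ (1 : Matrix (Fin b) (Fin b) ℂ)) * M = 1 := by
      rw [hM, ← Matrix.mul_kronecker_mul, Matrix.nonsing_inv_mul _ hRdet, Matrix.mul_one,
        Matrix.one_kronecker_one]
    have h4 : M * (R⁻¹ ⊗ₖ (1 : Matrix (Fin b) (Fin b) ℂ))ᴴ = 1 := by
      have := congrArg Matrix.conjTranspose h3
      rwa [Matrix.conjTranspose_mul, hMs, Matrix.conjTranspose_one] at this
    generalize R⁻¹ ⊗ₖ (1 : Matrix (Fin b) (Fin b) ℂ) = X at h2 h3 h4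
    have h5 : X * (M * γ * M) * Xᴴ = X * M * γ * (M * Xᴴ) := by simp only [Matrix.mul_assoc]
    rwa [h5, h3, h4, Matrix.one_mul, Matrix.mul_one] at h2

/-! ### Continuity of the parametrizations -/

instance instSecondCountableTopologySU (d : ℕ) : SecondCountableTopology (SU d) :=
  TopologicalSpace.Subtype.secondCountableTopology
    (Matrix.specialUnitaryGroup (Fin d) ℂ : Set (Matrix (Fin d) (Fin d) ℂ))

instance instSecondCountableTopologyIsom2 (b : ℕ) : SecondCountableTopology (Isom2 b) :=
  TopologicalSpace.Subtype.secondCountableTopology {V : Matrix (Fin b) (Fin 2) ℂ | Vᴴ * V = 1}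

theorem continuous_kronecker {X l m n p : Type*} [TopologicalSpace X] {A : X → Matrix l m ℂ}
    {B : X → Matrix n p ℂ} (hA : Continuous A) (hB : Continuous B) :
    Continuous fun x => A x ⊗ₖ B x :=
  continuous_matrix fun i j => (hA.matrix_elem i.1 j.1).mul (hB.matrix_elem i.2 j.2)

theorem continuous_proj {X n : Type*} [TopologicalSpace X] {ψ : X → n → ℂ} (h : Continuous ψ) :
    Continuous fun x => proj (ψ x) :=
  h.matrix_vecMulVec h.star

theorem continuous_qubitChoi : Continuous fun x : ℝ × ℝ => qubitChoi x.1 x.2 := by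
  refine continuous_matrix fun i j => ?_
  obtain ⟨i, m⟩ := i
  obtain ⟨j, n⟩ := j
  simp only [qubitChoi_apply, qubitChannel_eq]
  fin_cases m <;> fin_cases n <;> simp <;> fun_prop

theorem continuous_proj_col {a : ℕ} (k : Fin a) :
    Continuous fun U : SU a => proj (fun i => (U : Matrix (Fin a) (Fin a) ℂ) i k) :=
  continuous_proj (continuous_pi fun i => continuous_subtype_val.matrix_elem i k)

theorem continuous_proj_sphere {b : ℕ} :
    Continuous fun ψ : Sphere b => proj (fun m => (ψ : EuclideanSpace ℂ (Fin b)) m) :=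
  continuous_proj (by fun_prop)

theorem continuous_paramState {a b : ℕ} : Continuous (paramState : Param a b → BiMat a b) := by
  have hU : Continuous fun x : Param a b => (x.2.2.1 : Matrix (Fin a) (Fin a) ℂ) := by fun_prop
  have hV : Continuous fun x : Param a b => x.2.1.1 := by fun_prop
  have hL := continuous_kronecker (hU.matrix_mul (continuous_const (y := firstTwo a))) hV
  have hC : Continuous fun x : Param a b => qubitChoi x.1.1 x.1.2 :=
    continuous_qubitChoi.comp continuous_fst
  refine Continuous.const_smul (g := fun x : Param a b => _ + _)
    (((hL.matrix_mul hC).matrix_mul hL.matrix_conjTranspose).add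
      (continuous_finsetSum _ fun k _ => continuous_kronecker ?_ ?_)) (a : ℂ)⁻¹
  · exact (continuous_proj_col k.1).comp (by fun_prop : Continuous fun x : Param a b => x.2.2.1)
  · exact continuous_proj_sphere.comp (by fun_prop : Continuous fun x : Param a b => x.2.2.2 k)

theorem continuous_productState {a b : ℕ} :
    Continuous fun x : SU a × (Fin a → Sphere b) => productState x.1 x.2 := by
  refine Continuous.const_smul (g := fun x : SU a × (Fin a → Sphere b) => ∑ k, _)
    (continuous_finsetSum _ fun k _ => continuous_kronecker ?_ ?_) (a : ℂ)⁻¹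
  · exact (continuous_proj_col k).comp continuous_fst
  · exact continuous_proj_sphere.comp
      (by fun_prop : Continuous fun x : SU a × (Fin a → Sphere b) => x.2 k)

/-! ### The measure on block states -/

instance instIsProbabilityMeasureHaarSU (d : ℕ) : IsProbabilityMeasure (haarSU d) :=
  ⟨by simpa [haarSU] using Measure.haarMeasure_self (K₀ := (⊤ : TopologicalSpace.PositiveCompacts (SU d)))⟩

theorem isProbabilityMeasure_isomMeasure (b : ℕ) (hb : 2 ≤ b) :
    IsProbabilityMeasure (isomMeasure b hb) := by
  refine Measure.isProbabilityMeasure_map (Measurable.aemeasurable (Continuous.measurable ?_))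
  exact (continuous_subtype_val.matrix_mul continuous_const).subtype_mk _

theorem volume_square_ne_zero :
    volume (Set.Icc (0 : ℝ) (Real.pi / 2) ×ˢ Set.Icc (0 : ℝ) (Real.pi / 2)) ≠ 0 := by
  rw [Measure.volume_eq_prod, Measure.prod_prod, Real.volume_Icc]
  have := Real.pi_pos
  simp [this]

theorem volume_square_ne_top :
    volume (Set.Icc (0 : ℝ) (Real.pi / 2) ×ˢ Set.Icc (0 : ℝ) (Real.pi / 2)) ≠ ⊤ :=
  (isCompact_Icc.prod isCompact_Icc).measure_lt_top.ne

instance instIsProbabilityMeasureAngleMeasure : IsProbabilityMeasure angleMeasure :=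
  ProbabilityTheory.cond_isProbabilityMeasure_of_finite volume_square_ne_zero volume_square_ne_top

theorem ae_angleMeasure_mem_Ioo :
    ∀ᵐ x ∂angleMeasure, x ∈ Set.Ioo 0 (Real.pi / 2) ×ˢ Set.Ioo 0 (Real.pi / 2) := by
  have h1 : ∀ᵐ x ∂angleMeasure,
      x ∈ Set.Icc (0 : ℝ) (Real.pi / 2) ×ˢ Set.Icc (0 : ℝ) (Real.pi / 2) :=
    ProbabilityTheory.ae_cond_mem (measurableSet_Icc.prod measurableSet_Icc)
  have hac : angleMeasure ≪ volume := ProbabilityTheory.cond_absolutelyContinuous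
  have h2 : ∀ c : ℝ, ∀ᵐ x ∂angleMeasure, x.1 ≠ c ∧ x.2 ≠ c := by
    intro c
    have h0 : ∀ᵐ t : ℝ, t ≠ c := Measure.ae_ne volume c
    have hf : ∀ᵐ x : ℝ × ℝ, x.1 ≠ c := Measure.quasiMeasurePreserving_fst.ae h0
    have hs : ∀ᵐ x : ℝ × ℝ, x.2 ≠ c := Measure.quasiMeasurePreserving_snd.ae h0
    filter_upwards [hac.ae_le hf, hac.ae_le hs] with x h h' using ⟨h, h'⟩
  filter_upwards [h1, h2 0, h2 (Real.pi / 2)] with x hx h0 hpi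
  exact ⟨⟨lt_of_le_of_ne hx.1.1 h0.1.symm, lt_of_le_of_ne hx.1.2 hpi.1⟩,
    ⟨lt_of_le_of_ne hx.2.1 h0.2.symm, lt_of_le_of_ne hx.2.2 hpi.2⟩⟩

theorem ae_paramMeasure_mem_Ioo {a b : ℕ} (hb : 2 ≤ b) (n : Measure (Sphere b)) :
    ∀ᵐ x ∂paramMeasure a b hb n,
    x.1 ∈ Set.Ioo 0 (Real.pi / 2) ×ˢ Set.Ioo 0 (Real.pi / 2) := by
  have := isProbabilityMeasure_isomMeasure b hb
  exact Measure.quasiMeasurePreserving_fst.ae ae_angleMeasure_mem_Ioo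

theorem isProbabilityMeasure_paramMeasure {a b : ℕ} (hb : 2 ≤ b) (n : Measure (Sphere b))
    [IsProbabilityMeasure n] : IsProbabilityMeasure (paramMeasure a b hb n) := by
  have := isProbabilityMeasure_isomMeasure b hb
  rw [paramMeasure]
  infer_instance

theorem isProbabilityMeasure_blockMeasure {a b : ℕ} (hb : 2 ≤ b) (n : Measure (Sphere b))
    [IsProbabilityMeasure n] : IsProbabilityMeasure (blockMeasure a b hb n) := by
  have := isProbabilityMeasure_paramMeasure (a := a) hb n
  exact Measure.isProbabilityMeasure_map continuous_paramState.measurable.aemeasurable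

theorem blockMeasure_compl_channelStates {a b : ℕ} (hb : 2 ≤ b) (n : Measure (Sphere b))
    (ha : 2 ≤ a) :
    blockMeasure a b hb n (channelStates a b)ᶜ = 0 := by
  let O : Set (ℝ × ℝ) := Set.Ioo 0 (Real.pi / 2) ×ˢ Set.Ioo 0 (Real.pi / 2)
  have hO : LocallyCompactSpace O := (isOpen_Ioo.prod isOpen_Ioo).locallyCompactSpace
  have hV : SigmaCompactSpace (Isom2 b) := by
    have : IsClosed {V : Matrix (Fin b) (Fin 2) ℂ | Vᴴ * V = 1} :=
      isClosed_eq (continuous_id.matrix_conjTranspose.matrix_mul continuous_id) continuous_const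
    have : LocallyCompactSpace (Matrix (Fin b) (Fin 2) ℂ) :=
      inferInstanceAs (LocallyCompactSpace (Fin b → Fin 2 → ℂ))
    exact (IsClosed.isClosedEmbedding_subtypeVal ‹IsClosed _›).sigmaCompactSpace
  let f : O × Isom2 b × SU a × (Tail a → Sphere b) → BiMat a b :=
    fun y => paramState (y.1.1, y.2)
  have hf : Continuous f := continuous_paramState.comp (by fun_prop)
  -- The image of the σ-compact parameter space over the open square is Borel and lies in
  -- `channelStates`, so measurability of `channelStates` itself is not required.
  have hmeas : MeasurableSet (Set.range f) := by
    obtain ⟨K, hK, hKu⟩ := isSigmaCompact_range hf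
    rw [← hKu]
    exact MeasurableSet.iUnion fun i => (hK i).measurableSet
  have hsub : (channelStates a b)ᶜ ⊆ (Set.range f)ᶜ := by
    refine Set.compl_subset_compl.2 ?_
    rintro _ ⟨y, rfl⟩
    exact paramState_mem_channelStates ha y.1.2
  refine measure_mono_null hsub ?_
  rw [blockMeasure, Measure.map_apply continuous_paramState.measurable hmeas.compl]
  have h := ae_paramMeasure_mem_Ioo (a := a) hb n
  rw [ae_iff] at h
  refine measure_mono_null ?_ h
  intro x hx hx'
  exact hx ⟨(⟨x.1, hx'⟩, x.2), rfl⟩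

theorem isCompact_range_productState (a b : ℕ) :
    IsCompact (Set.range fun x : SU a × (Fin a → Sphere b) => productState x.1 x.2) :=
  isCompact_range continuous_productState

theorem blockMeasure_range_productState {a b : ℕ} (hb : 2 ≤ b) (n : Measure (Sphere b))
    (ha : 2 ≤ a) : blockMeasure a b hb n
    (Set.range fun x : SU a × (Fin a → Sphere b) => productState x.1 x.2) = 0 := by
  rw [blockMeasure, Measure.map_apply continuous_paramState.measurable
    (isCompact_range_productState a b).measurableSet]
  have h := ae_paramMeasure_mem_Ioo (a := a) hb n
  rw [ae_iff] at h
  refine measure_mono_null ?_ h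
  rintro x ⟨y, hy⟩ hx'
  refine paramState_notMem_sepCone ha hx' ?_
  rw [← hy]
  exact productState_mem_sepCone _ _

/-- All separable members of `channelStates` lie in the range of `productState`, a compact, hence
Borel, subset of 𝒴. Since ω is tied to μ on 𝒴, the null value transfers from μ to ω. -/
theorem ae_mem_channelStates_notMem_sepCone {a b : ℕ} (hb : 2 ≤ b) (n : Measure (Sphere b))
    (ha : 2 ≤ a) {ω : Measure (BiMat a b)}
    (h0 : ω (channelStates a b)ᶜ = 0)
    (hω : ∀ X ⊆ blockStates a b, MeasurableSet X → ω X = blockMeasure a b hb n X) :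
    ∀ᵐ γ ∂ω, γ ∈ channelStates a b ∧ γ ∉ sepCone a b := by
  have hS := hω (Set.range fun x : SU a × (Fin a → Sphere b) => productState x.1 x.2)
    (by rintro _ ⟨x, rfl⟩; exact productState_mem_blockStates ha hb _ _)
    (isCompact_range_productState a b).measurableSet
  rw [blockMeasure_range_productState hb n ha] at hS
  have h1 : ∀ᵐ γ ∂ω, γ ∈ channelStates a b := h0
  have h2 : ∀ᵐ γ ∂ω,
      γ ∉ Set.range fun x : SU a × (Fin a → Sphere b) => productState x.1 x.2 :=
    measure_eq_zero_iff_ae_notMem.1 hS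
  filter_upwards [h1, h2] with γ hγ hγ'
  refine ⟨hγ, fun hsep => hγ' ?_⟩
  obtain ⟨U, ψ, h⟩ := exists_productState_of_mem_sepCone (by omega) hγ hsep
  exact ⟨(U, ψ), h.symm⟩

/-! ### The measure on density matrices of full rank -/

theorem continuous_simplexPoint (d : ℕ) (i : Fin d) :
    Continuous fun w : Fin (d - 1) → ℝ => simplexPoint d w i := by
  unfold simplexPoint
  split_ifs <;> fun_prop

theorem measurableSet_orderedSimplex (d : ℕ) : MeasurableSet (orderedSimplex d) := by
  have h : orderedSimplex d = (⋂ i, {w | 0 < simplexPoint d w i}) ∩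
      ⋂ i, ⋂ j, ⋂ (_ : i ≤ j), {w | simplexPoint d w i ≤ simplexPoint d w j} := by
    ext w
    simp [orderedSimplex, Monotone]
  rw [h]
  refine (MeasurableSet.iInter fun i => ?_).inter (MeasurableSet.iInter fun i =>
    MeasurableSet.iInter fun j => MeasurableSet.iInter fun _ => ?_)
  · exact (isOpen_lt continuous_const (continuous_simplexPoint d i)).measurableSet
  · exact (isClosed_le (continuous_simplexPoint d i) (continuous_simplexPoint d j)).measurableSet

theorem sum_simplexPoint {d : ℕ} (hd : 0 < d) (w : Fin (d - 1) → ℝ) :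
    ∑ i, simplexPoint d w i = 1 := by
  obtain ⟨n, rfl⟩ : ∃ n, d = n + 1 := ⟨d - 1, by omega⟩
  rw [Fin.sum_univ_castSucc]
  have h1 : ∀ i : Fin n, simplexPoint (n + 1) w i.castSucc = w i := by
    intro i
    simp [simplexPoint]
  have h2 : simplexPoint (n + 1) w (Fin.last n) = 1 - ∑ k : Fin n, w k := by
    simp [simplexPoint]
  rw [h2, Finset.sum_congr rfl fun i _ => h1 i]
  ring

theorem simplexPoint_eq {d : ℕ} (s : Fin d → ℝ) (hs : ∑ i, s i = 1) :
    simplexPoint d (fun k => s ⟨k, by omega⟩) = s := by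
  funext i
  obtain ⟨n, rfl⟩ : ∃ n, d = n + 1 := ⟨d - 1, by have := i.2; omega⟩
  rw [Fin.sum_univ_castSucc] at hs
  refine Fin.lastCases ?_ (fun j => ?_) i
  · simp only [simplexPoint, Nat.add_sub_cancel, Fin.val_last, lt_irrefl, dif_neg, not_false_eq_true]
    rw [← hs]
    exact add_sub_cancel_left _ _
  · simp [simplexPoint]
    rfl

theorem volume_orderedSimplex_ne_zero {d : ℕ} (hd : 0 < d) : volume (orderedSimplex d) ≠ 0 := by
  -- The strictly ordered points form an open subset, nonempty because it contains the normalization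
  -- of (1, 2, …, d).
  let O : Set (Fin (d - 1) → ℝ) := (⋂ i, {w | 0 < simplexPoint d w i}) ∩
      ⋂ i, ⋂ j, ⋂ (_ : i < j), {w | simplexPoint d w i < simplexPoint d w j}
  have hO : IsOpen O := by
    refine (isOpen_iInter_of_finite fun i => ?_).inter (isOpen_iInter_of_finite fun i =>
      isOpen_iInter_of_finite fun j => isOpen_iInter_of_finite fun _ => ?_)
    · exact isOpen_lt continuous_const (continuous_simplexPoint d i)
    · exact isOpen_lt (continuous_simplexPoint d i) (continuous_simplexPoint d j)
  have hsub : O ⊆ orderedSimplex d := by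
    intro w hw
    simp only [O, Set.mem_inter_iff, Set.mem_iInter, Set.mem_ofPred_eq] at hw
    exact ⟨hw.1, StrictMono.monotone fun i j hij => hw.2 i j hij⟩
  let c : ℝ := ∑ i : Fin d, ((i : ℝ) + 1)
  have hc : 0 < c := by
    have : Nonempty (Fin d) := ⟨⟨0, hd⟩⟩
    exact Finset.sum_pos (fun i _ => by positivity) Finset.univ_nonempty
  have hs := simplexPoint_eq (fun i : Fin d => ((i : ℝ) + 1) / c)
    (by rw [← Finset.sum_div]; exact div_self hc.ne')
  have hne : O.Nonempty := by
    refine ⟨fun k => (((⟨k, by omega⟩ : Fin d) : ℕ) + 1 : ℝ) / c, ?_, ?_⟩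
    · simp only [Set.mem_iInter, Set.mem_ofPred_eq]
      intro i
      rw [hs]
      positivity
    · simp only [Set.mem_iInter, Set.mem_ofPred_eq]
      intro i j hij
      rw [hs]
      have : (i : ℝ) < j := by exact_mod_cast hij
      exact (div_lt_div_iff_of_pos_right hc).2 (by linarith)
  exact fun h => (hO.measure_pos volume hne).ne' (measure_mono_null hsub h)

theorem volume_orderedSimplex_ne_top {d : ℕ} (hd : 0 < d) : volume (orderedSimplex d) ≠ ⊤ := by
  have hsub : orderedSimplex d ⊆ Set.Icc 0 1 := by
    intro w hw
    have h1 : ∀ k : Fin (d - 1), simplexPoint d w ⟨k, by omega⟩ = w k := by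
      intro k
      simp [simplexPoint]
    refine ⟨fun k => ?_, fun k => ?_⟩
    · rw [← h1]
      exact (hw.1 _).le
    · rw [← h1, Pi.one_apply, ← sum_simplexPoint hd w]
      exact Finset.single_le_sum (fun i _ => (hw.1 i).le) (Finset.mem_univ _)
  exact ((measure_mono hsub).trans_lt isCompact_Icc.measure_lt_top).ne

theorem isProbabilityMeasure_cond_orderedSimplex {d : ℕ} (hd : 0 < d) :
    IsProbabilityMeasure (ProbabilityTheory.cond volume (orderedSimplex d)) :=
  ProbabilityTheory.cond_isProbabilityMeasure_of_finite (volume_orderedSimplex_ne_zero hd)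
    (volume_orderedSimplex_ne_top hd)

theorem continuous_conj_diagonal_simplexPoint (d : ℕ) :
    Continuous fun p : (Fin (d - 1) → ℝ) × SU d => (p.2 : Matrix (Fin d) (Fin d) ℂ) *
      Matrix.diagonal (fun i => (simplexPoint d p.1 i : ℂ)) *
        (p.2 : Matrix (Fin d) (Fin d) ℂ)ᴴ := by
  have hU : Continuous fun p : (Fin (d - 1) → ℝ) × SU d => (p.2 : Matrix (Fin d) (Fin d) ℂ) := by
    fun_prop
  refine (hU.matrix_mul (Continuous.matrix_diagonal (continuous_pi fun i => ?_))).matrix_mul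
    hU.matrix_conjTranspose
  exact Complex.continuous_ofReal.comp ((continuous_simplexPoint d i).comp continuous_fst)

theorem isProbabilityMeasure_marginalMeasure {d : ℕ} (hd : 0 < d) :
    IsProbabilityMeasure (marginalMeasure d) := by
  have := isProbabilityMeasure_cond_orderedSimplex hd
  exact Measure.isProbabilityMeasure_map
    (continuous_conj_diagonal_simplexPoint d).measurable.aemeasurable

theorem measurableSet_posSemidef (n : Type*) [Fintype n] [DecidableEq n] :
    MeasurableSet {ρ : Matrix n n ℂ | ρ.PosSemidef} := by
  have h : {ρ : Matrix n n ℂ | ρ.PosSemidef} =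
      {ρ | ρᴴ = ρ} ∩ ⋂ x : n → ℂ, {ρ | 0 ≤ star x ⬝ᵥ ρ *ᵥ x} := by
    ext ρ
    simp [Matrix.posSemidef_iff_dotProduct_mulVec, Matrix.IsHermitian]
  rw [h]
  refine IsClosed.measurableSet ((isClosed_eq continuous_id.matrix_conjTranspose
    continuous_id).inter (isClosed_iInter fun x => isClosed_le continuous_const ?_))
  exact continuous_const.dotProduct (continuous_id.matrix_mulVec continuous_const)

theorem ae_marginalMeasure {d : ℕ} (hd : 0 < d) :
    ∀ᵐ ρ ∂marginalMeasure d, ρ.PosSemidef ∧ ρ.det ≠ 0 ∧ ρ.trace = 1 := by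
  have := isProbabilityMeasure_cond_orderedSimplex hd
  have hmeas : MeasurableSet {ρ : Matrix (Fin d) (Fin d) ℂ |
      ρ.PosSemidef ∧ ρ.det ≠ 0 ∧ ρ.trace = 1} :=
    (measurableSet_posSemidef _).inter (MeasurableSet.inter
      (isOpen_ne_fun continuous_id.matrix_det continuous_const).measurableSet
      (isClosed_eq continuous_id.matrix_trace continuous_const).measurableSet)
  rw [marginalMeasure, ae_map_iff
    (continuous_conj_diagonal_simplexPoint d).measurable.aemeasurable hmeas]
  have h : ∀ᵐ p ∂(ProbabilityTheory.cond volume (orderedSimplex d)).prod (haarSU d),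
      p.1 ∈ orderedSimplex d := Measure.quasiMeasurePreserving_fst.ae
        (ProbabilityTheory.ae_cond_mem (measurableSet_orderedSimplex d))
  filter_upwards [h] with p hp
  have hUU : (p.2 : Matrix (Fin d) (Fin d) ℂ)ᴴ * (p.2 : Matrix (Fin d) (Fin d) ℂ) = 1 :=
    Matrix.mem_unitaryGroup_iff'.1 (Matrix.specialUnitaryGroup_le_unitaryGroup p.2.2)
  have hdet : (p.2 : Matrix (Fin d) (Fin d) ℂ).det = 1 :=
    (Matrix.mem_specialUnitaryGroup_iff.1 p.2.2).2
  refine ⟨Matrix.PosSemidef.mul_mul_conjTranspose_same (Matrix.PosSemidef.diagonal ?_) _, ?_, ?_⟩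
  · intro i
    exact Complex.zero_le_real.2 (hp.1 i).le
  · rw [Matrix.det_mul, Matrix.det_mul, Matrix.det_conjTranspose, hdet, Matrix.det_diagonal]
    simp only [star_one, one_mul, mul_one]
    exact Finset.prod_ne_zero_iff.2 fun i _ => Complex.ofReal_ne_zero.2 (hp.1 i).ne'
  · rw [Matrix.trace_mul_comm, ← Matrix.mul_assoc, hUU, Matrix.one_mul, Matrix.trace_diagonal,
      ← Complex.ofReal_sum, sum_simplexPoint hd, Complex.ofReal_one]

theorem ae_withMarginal {a b : ℕ} (ha : 0 < a) {ω : Measure (BiMat a b)} [SFinite ω]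
    (hω : ∀ᵐ γ ∂ω, γ ∈ channelStates a b ∧ γ ∉ sepCone a b) :
    ∀ᵐ p ∂(ω.prod (marginalMeasure a)),
      withMarginal p ∈ statesOfRank a b a a ∧ IsEntangled (withMarginal p) := by
  have := isProbabilityMeasure_marginalMeasure ha
  filter_upwards [Measure.quasiMeasurePreserving_fst.ae hω,
    Measure.quasiMeasurePreserving_snd.ae (ae_marginalMeasure ha)] with p h1 h2
  exact withMarginal_mem_and_isEntangled ha h1.1 h1.2 h2.1 h2.2.1 h2.2.2

/-! ### Generic matrices -/

/-- Fubini along the lines parallel to v. -/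
theorem ae_of_forall_ae_line {E : Type*} [NormedAddCommGroup E] [NormedSpace ℝ E]
    [FiniteDimensional ℝ E] [MeasurableSpace E] [BorelSpace E] (ν : Measure E)
    [ν.IsAddHaarMeasure] {s : Set E} (hs : MeasurableSet s) (v : E)
    (h : ∀ y, ∀ᵐ t : ℝ, y + t • v ∈ s) : ∀ᵐ y ∂ν, y ∈ s := by
  have := FiniteDimensional.proper_real E
  exact ae_mem_of_ae_add_linearMap_mem (LinearMap.toSpanSingleton ℝ E v) volume ν hs h

theorem ae_eval_ofReal_ne_zero {p : Polynomial ℂ} (hp : p ≠ 0) :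
    ∀ᵐ t : ℝ, p.eval (t : ℂ) ≠ 0 := by
  have h : {t : ℝ | p.eval (t : ℂ) = 0}.Finite := by
    refine Set.Finite.subset (p.roots.toFinset.finite_toSet.preimage
      Complex.ofReal_injective.injOn) fun t ht => ?_
    simpa [hp] using ht
  exact measure_eq_zero_iff_ae_notMem.1 (h.measure_zero volume)

theorem ae_det_add_smul_one_ne_zero {n : Type*} [Fintype n] [DecidableEq n] (A : Matrix n n ℂ) :
    ∀ᵐ t : ℝ, (A + (t : ℂ) • (1 : Matrix n n ℂ)).det ≠ 0 := by
  filter_upwards [ae_eval_ofReal_ne_zero (Matrix.charpoly_monic (-A)).ne_zero] with t ht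
  rw [Matrix.eval_charpoly] at ht
  rwa [Matrix.smul_one_eq_diagonal, add_comm, ← sub_neg_eq_add]

/-- A real t passes unchanged through the conjugate transpose, so each entry of the commutator is a
polynomial in t whose quadratic coefficient comes from Y alone. -/
theorem ae_add_smul_not_normal {n : Type*} [Fintype n] [DecidableEq n] (X : Matrix n n ℂ)
    {Y : Matrix n n ℂ} (hY : Y * Yᴴ ≠ Yᴴ * Y) :
    ∀ᵐ t : ℝ, (X + (t : ℂ) • Y) * (X + (t : ℂ) • Y)ᴴ ≠ (X + (t : ℂ) • Y)ᴴ * (X + (t : ℂ) • Y) := by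
  obtain ⟨i, j, hij⟩ : ∃ i j, (Y * Yᴴ - Yᴴ * Y) i j ≠ 0 := by
    by_contra! h
    exact hY (sub_eq_zero.1 (Matrix.ext h))
  let p : Polynomial ℂ := Polynomial.C ((X * Xᴴ - Xᴴ * X) i j) +
    Polynomial.C ((X * Yᴴ + Y * Xᴴ - Xᴴ * Y - Yᴴ * X) i j) * Polynomial.X +
    Polynomial.C ((Y * Yᴴ - Yᴴ * Y) i j) * Polynomial.X ^ 2
  have hp : p ≠ 0 := by
    intro h
    have : p.coeff 2 = (Y * Yᴴ - Yᴴ * Y) i j := by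
      simp only [p, Polynomial.coeff_add, Polynomial.coeff_C_mul, Polynomial.coeff_X_pow,
        Polynomial.coeff_X, Polynomial.coeff_C]
      norm_num
    exact hij (by rw [← this, h, Polynomial.coeff_zero])
  filter_upwards [ae_eval_ofReal_ne_zero hp] with t ht h
  refine ht ?_
  have h1 : (X + (t : ℂ) • Y) * (X + (t : ℂ) • Y)ᴴ - (X + (t : ℂ) • Y)ᴴ * (X + (t : ℂ) • Y) =
      (X * Xᴴ - Xᴴ * X) + (t : ℂ) • (X * Yᴴ + Y * Xᴴ - Xᴴ * Y - Yᴴ * X) +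
        (t : ℂ) ^ 2 • (Y * Yᴴ - Yᴴ * Y) := by
    rw [Matrix.conjTranspose_add, Matrix.conjTranspose_smul, Complex.star_def, Complex.conj_ofReal]
    simp only [Matrix.mul_add, Matrix.add_mul, Matrix.smul_mul, Matrix.mul_smul]
    module
  have h2 := congrFun₂ h1 i j
  rw [sub_eq_zero.2 h] at h2
  simp only [Matrix.add_apply, Matrix.smul_apply, Matrix.zero_apply, smul_eq_mul] at h2
  simp only [p, Polynomial.eval_add, Polynomial.eval_mul, Polynomial.eval_C, Polynomial.eval_X,
    Polynomial.eval_pow]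
  rw [h2]
  ring

/-- The adjugate is a nonzero multiple of the inverse, and inverting a normal matrix gives a normal
matrix. -/
theorem adjugate_not_normal {n : Type*} [Fintype n] [DecidableEq n] {A : Matrix n n ℂ}
    (hdet : A.det ≠ 0) (hA : A * Aᴴ ≠ Aᴴ * A) :
    A.adjugate * A.adjugateᴴ ≠ A.adjugateᴴ * A.adjugate := by
  intro h
  have hu : IsUnit A.det := isUnit_iff_ne_zero.2 hdet
  have hadj : A.adjugate = A.det • A⁻¹ := by
    rw [Matrix.inv_def, smul_smul, Ring.mul_inverse_cancel _ hu, one_smul]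
  rw [hadj, Matrix.conjTranspose_smul] at h
  simp only [Matrix.smul_mul, Matrix.mul_smul, smul_smul] at h
  rw [mul_comm (star A.det)] at h
  have h1 := smul_right_injective _ (mul_ne_zero hdet (star_ne_zero.2 hdet)) h
  rw [Matrix.conjTranspose_nonsing_inv, ← Matrix.mul_inv_rev, ← Matrix.mul_inv_rev] at h1
  have h2 : IsUnit (A * Aᴴ).det := by
    rw [Matrix.det_mul, Matrix.det_conjTranspose]
    exact hu.mul hu.star
  have h3 : IsUnit (Aᴴ * A).det := by
    rw [Matrix.det_mul, Matrix.det_conjTranspose]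
    exact hu.star.mul hu
  refine hA ?_
  rw [← Matrix.nonsing_inv_nonsing_inv _ h2, ← Matrix.nonsing_inv_nonsing_inv _ h3, h1]

theorem single_not_normal {n : Type*} [Fintype n] [DecidableEq n] {i j : n} (hij : i ≠ j) :
    (Matrix.single i j 1 : Matrix n n ℂ) * (Matrix.single i j 1 : Matrix n n ℂ)ᴴ ≠
      (Matrix.single i j 1 : Matrix n n ℂ)ᴴ * (Matrix.single i j 1 : Matrix n n ℂ) := by
  intro h
  have := congrFun₂ h i i
  simp [Matrix.conjTranspose_single, hij.symm] at this

/-! ### Perturbation of a single slice -/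

section slices

variable {a b : ℕ}

/-- The matrix with one nonzero slice. -/
def sliceDirection (m : Fin b) (Y : Matrix (Fin a) (Fin a) ℂ) : Fin a × Fin b → Fin a → ℂ :=
  fun p r => if p.2 = m then Y p.1 r else 0

theorem slice_add_smul_sliceDirection (M : Fin a × Fin b → Fin a → ℂ) (t : ℝ) (m : Fin b)
    (Y : Matrix (Fin a) (Fin a) ℂ) :
    slice (Matrix.of (M + t • sliceDirection m Y)) m = slice (Matrix.of M) m + (t : ℂ) • Y := by
  ext i r
  simp [slice, sliceDirection]

theorem slice_add_smul_sliceDirection_of_ne (M : Fin a × Fin b → Fin a → ℂ) (t : ℝ)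
    {m m' : Fin b} (h : m' ≠ m) (Y : Matrix (Fin a) (Fin a) ℂ) :
    slice (Matrix.of (M + t • sliceDirection m Y)) m' = slice (Matrix.of M) m' := by
  ext i r
  simp [slice, sliceDirection, h]

theorem continuous_slice (m : Fin b) :
    Continuous fun M : Fin a × Fin b → Fin a → ℂ => slice (Matrix.of M) m :=
  continuous_matrix fun i r => by
    simp only [slice, Matrix.of_apply]
    fun_prop

theorem isAddHaarMeasure_volume_slices :
    (volume : Measure (Fin a × Fin b → Fin a → ℂ)).IsAddHaarMeasure := by
  have h : (volume : Measure (Fin a → ℂ)).IsAddHaarMeasure := by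
    rw [volume_pi]
    infer_instance
  rw [volume_pi]
  exact Measure.pi.isAddHaarMeasure _

theorem ae_det_slice_ne_zero (m : Fin b) :
    ∀ᵐ M : Fin a × Fin b → Fin a → ℂ, (slice (Matrix.of M) m).det ≠ 0 := by
  have := isAddHaarMeasure_volume_slices (a := a) (b := b)
  refine ae_of_forall_ae_line volume (s := {M | (slice (Matrix.of M) m).det ≠ 0})
    (isOpen_ne_fun (continuous_slice m).matrix_det continuous_const).measurableSet
    (sliceDirection m 1) fun M => ?_
  filter_upwards [ae_det_add_smul_one_ne_zero (slice (Matrix.of M) m)] with t ht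
  rwa [slice_add_smul_sliceDirection]

theorem ae_slice_not_normal (ha : 2 ≤ a) (m : Fin b) :
    ∀ᵐ M : Fin a × Fin b → Fin a → ℂ, slice (Matrix.of M) m * (slice (Matrix.of M) m)ᴴ ≠
      (slice (Matrix.of M) m)ᴴ * slice (Matrix.of M) m := by
  have := isAddHaarMeasure_volume_slices (a := a) (b := b)
  have hc := continuous_slice (a := a) m
  refine ae_of_forall_ae_line volume (s := {M | slice (Matrix.of M) m * (slice (Matrix.of M) m)ᴴ ≠
      (slice (Matrix.of M) m)ᴴ * slice (Matrix.of M) m})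
    (isOpen_ne_fun (hc.matrix_mul hc.matrix_conjTranspose)
      (hc.matrix_conjTranspose.matrix_mul hc)).measurableSet
    (sliceDirection m (Matrix.single ⟨0, by omega⟩ ⟨1, by omega⟩ 1)) fun M => ?_
  filter_upwards [ae_add_smul_not_normal (slice (Matrix.of M) m)
    (single_not_normal (i := (⟨0, by omega⟩ : Fin a)) (j := ⟨1, by omega⟩) (by simp))] with t ht
  rwa [slice_add_smul_sliceDirection]

theorem ae_adjugate_slice_mul_slice_not_normal (ha : 2 ≤ a) {m m' : Fin b} (hm : m ≠ m') :
    ∀ᵐ M : Fin a × Fin b → Fin a → ℂ,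
      (slice (Matrix.of M) m).adjugate * slice (Matrix.of M) m' *
          ((slice (Matrix.of M) m).adjugate * slice (Matrix.of M) m')ᴴ ≠
        ((slice (Matrix.of M) m).adjugate * slice (Matrix.of M) m')ᴴ *
          ((slice (Matrix.of M) m).adjugate * slice (Matrix.of M) m') := by
  have := isAddHaarMeasure_volume_slices (a := a) (b := b)
  have hc := continuous_slice (a := a) m
  have hd := hc.matrix_adjugate.matrix_mul (continuous_slice (a := a) m')
  -- The exceptional base points are added to the set so that the criterion holds on every line. The
  -- lines move only the slice m', so the exceptional conditions on the slice m are constant along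
  -- them; otherwise adj(W_m), the direction of motion of the product, is not normal.
  have h : ∀ᵐ M : Fin a × Fin b → Fin a → ℂ, M ∈ ({M | (slice (Matrix.of M) m).det = 0} ∪
      {M | slice (Matrix.of M) m * (slice (Matrix.of M) m)ᴴ =
        (slice (Matrix.of M) m)ᴴ * slice (Matrix.of M) m}) ∪
      {M | (slice (Matrix.of M) m).adjugate * slice (Matrix.of M) m' *
          ((slice (Matrix.of M) m).adjugate * slice (Matrix.of M) m')ᴴ ≠
        ((slice (Matrix.of M) m).adjugate * slice (Matrix.of M) m')ᴴ *
          ((slice (Matrix.of M) m).adjugate * slice (Matrix.of M) m')} := by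
    refine ae_of_forall_ae_line volume (MeasurableSet.union (MeasurableSet.union
      (isClosed_eq hc.matrix_det continuous_const).measurableSet
      (isClosed_eq (hc.matrix_mul hc.matrix_conjTranspose)
        (hc.matrix_conjTranspose.matrix_mul hc)).measurableSet)
      (isOpen_ne_fun (hd.matrix_mul hd.matrix_conjTranspose)
        (hd.matrix_conjTranspose.matrix_mul hd)).measurableSet)
      (sliceDirection m' 1) fun M => ?_
    simp only [Set.mem_union, Set.mem_ofPred_eq, slice_add_smul_sliceDirection,
      slice_add_smul_sliceDirection_of_ne _ _ hm]
    by_cases h1 : (slice (Matrix.of M) m).det = 0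
    · exact Filter.Eventually.of_forall fun _ => Or.inl (Or.inl h1)
    by_cases h2 : slice (Matrix.of M) m * (slice (Matrix.of M) m)ᴴ =
        (slice (Matrix.of M) m)ᴴ * slice (Matrix.of M) m
    · exact Filter.Eventually.of_forall fun _ => Or.inl (Or.inr h2)
    filter_upwards [ae_add_smul_not_normal
      ((slice (Matrix.of M) m).adjugate * slice (Matrix.of M) m')
      (adjugate_not_normal h1 h2)] with t ht
    right
    rwa [Matrix.mul_add, Matrix.mul_smul, Matrix.mul_one]
  filter_upwards [h, ae_det_slice_ne_zero m, ae_slice_not_normal ha m] with M hM h1 h2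
  rcases hM with (hM | hM) | hM
  · exact absurd hM h1
  · exact absurd hM h2
  · exact hM

/-- One invertible summand makes the whole sum definite. Applied to the slices and to their
adjoints, it gives full rank of the marginal and of W†W from a single invertible slice. -/
theorem sum_mul_conjTranspose_posDef {ι n : Type*} [Fintype ι] [Fintype n] [DecidableEq n]
    {A : ι → Matrix n n ℂ} {m : ι} (hm : (A m).det ≠ 0) : (∑ k, A k * (A k)ᴴ).PosDef := by
  classical
  rw [← Finset.add_sum_erase _ _ (Finset.mem_univ m)]
  refine Matrix.PosDef.add_posSemidef (Matrix.PosDef.mul_conjTranspose_self _ ?_)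
    (Matrix.posSemidef_sum _ fun k _ => Matrix.posSemidef_self_mul_conjTranspose _)
  exact Matrix.vecMul_injective_iff_isUnit.2 ((Matrix.isUnit_iff_isUnit_det _).2
    (isUnit_iff_ne_zero.2 hm))

theorem conjTranspose_mul_self_eq_sum_slice (W : Matrix (Fin a × Fin b) (Fin a) ℂ) :
    Wᴴ * W = ∑ m, (slice W m)ᴴ * ((slice W m)ᴴ)ᴴ := by
  ext r s
  rw [Matrix.mul_apply, Matrix.sum_apply, Fintype.sum_prod_type, Finset.sum_comm]
  refine Finset.sum_congr rfl fun m _ => ?_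
  rw [Matrix.conjTranspose_conjTranspose, Matrix.mul_apply]
  rfl

theorem inducedState_mem_and_isEntangled (ha : 0 < a) {W : Matrix (Fin a × Fin b) (Fin a) ℂ}
    {m m' : Fin b} (hdet : (slice W m).det ≠ 0)
    (hnormal : (slice W m).adjugate * slice W m' * ((slice W m).adjugate * slice W m')ᴴ ≠
      ((slice W m).adjugate * slice W m')ᴴ * ((slice W m).adjugate * slice W m')) :
    inducedState W ∈ statesOfRank a b a a ∧ IsEntangled (inducedState W) := by
  have : Nonempty (Fin a) := ⟨⟨0, ha⟩⟩
  have hWW : (Wᴴ * W).PosDef := by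
    rw [conjTranspose_mul_self_eq_sum_slice]
    refine sum_mul_conjTranspose_posDef (m := m) ?_
    rw [Matrix.det_conjTranspose]
    exact star_ne_zero.2 hdet
  have htr : (traceB (W * Wᴴ)).PosDef := by
    rw [traceB_mul_conjTranspose]
    exact sum_mul_conjTranspose_posDef hdet
  have hWdet : IsUnit (Wᴴ * W).det := (Matrix.isUnit_iff_isUnit_det _).1 hWW.isUnit
  have htrdet : IsUnit (traceB (W * Wᴴ)).det := (Matrix.isUnit_iff_isUnit_det _).1 htr.isUnit
  have hpos : 0 < (W * Wᴴ).trace := by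
    rw [Matrix.trace_mul_comm]
    exact hWW.trace_pos
  obtain ⟨c, hc, hcW⟩ : ∃ c : ℝ, 0 < c ∧ (W * Wᴴ).trace = c := by
    rw [Complex.pos_iff] at hpos
    exact ⟨_, hpos.1, Complex.ext rfl (by simpa using hpos.2.symm)⟩
  have hc0 : (c : ℂ) ≠ 0 := Complex.ofReal_ne_zero.2 hc.ne'
  have hind : inducedState W = (c : ℂ)⁻¹ • (W * Wᴴ) := by rw [inducedState, hcW]
  have hstate : IsState (inducedState W) := by
    rw [hind]
    refine ⟨(Matrix.posSemidef_self_mul_conjTranspose W).smul ?_, ?_⟩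
    · rw [← Complex.ofReal_inv]
      exact Complex.zero_le_real.2 (inv_nonneg.2 hc.le)
    · rw [Matrix.trace_smul, hcW, smul_eq_mul, inv_mul_cancel₀ hc0]
  refine ⟨⟨hstate, ?_, ?_⟩, hstate, fun hs => hnormal ?_⟩
  · rw [hind, rank_smul_of_ne_zero (inv_ne_zero hc0), Matrix.rank_self_mul_conjTranspose,
      ← Matrix.rank_conjTranspose_mul_self, (isUnit_det_iff_rank _).1 hWdet, Fintype.card_fin]
  · rw [hind, traceB_smul, rank_smul_of_ne_zero (inv_ne_zero hc0),
      (isUnit_det_iff_rank _).1 htrdet, Fintype.card_fin]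
  · have h1 := smul_mem_sepCone hs.mem_sepCone hc.le
    rw [hind, smul_smul, mul_inv_cancel₀ hc0, one_smul] at h1
    exact commute_adjugate_mul_of_mem_sepCone h1 hWdet htrdet m m'

end slices

end Bipartite

end

open Bipartite
theorem theorem6 (a b : ℕ) (hb : 2 ≤ b) (hab : b ≤ a) :
    (∀ (n : Measure (Sphere b)) [IsProbabilityMeasure n],
      IsProbabilityMeasure (blockMeasure a b hb n) ∧
      IsProbabilityMeasure (marginalMeasure a) ∧
      blockMeasure a b hb n (channelStates a b)ᶜ = 0 ∧
      ∀ (ω : Measure (BiMat a b)) [SFinite ω],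
        ω (channelStates a b)ᶜ = 0 →
        (∀ X ⊆ blockStates a b, MeasurableSet X → ω X = blockMeasure a b hb n X) →
        ∀ᵐ p ∂(ω.prod (marginalMeasure a)),
          withMarginal p ∈ statesOfRank a b a a ∧ IsEntangled (withMarginal p)) ∧
    (∀ᵐ M : Fin a × Fin b → Fin a → ℂ,
      inducedState (Matrix.of M) ∈ statesOfRank a b a a ∧
        IsEntangled (inducedState (Matrix.of M))) := by
  have ha : 2 ≤ a := hb.trans hab
  have ha0 : 0 < a := by omega
  refine ⟨fun n _ => ⟨isProbabilityMeasure_blockMeasure hb n,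
    isProbabilityMeasure_marginalMeasure ha0, blockMeasure_compl_channelStates hb n ha,
    fun ω _ h0 hω => ae_withMarginal ha0 (ae_mem_channelStates_notMem_sepCone hb n ha h0 hω)⟩, ?_⟩
  have hne : (⟨0, by omega⟩ : Fin b) ≠ ⟨1, by omega⟩ := by simp
  filter_upwards [ae_det_slice_ne_zero ⟨0, by omega⟩,
    ae_adjugate_slice_mul_slice_not_normal ha hne] with M h1 h2
  exact inducedState_mem_and_isEntangled ha0 h1 h2
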